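/- **Conventions.** In an involutory quandle (a set with an operation $\rhd$ such that $x\rhd x=x$, $(x\rhd y)\rhd y=x$, $(x\rhd y)\rhd z=(x\rhd z)\rhd(y\rhd z)$) write $x^{y}=x\rhd y$ and $x^{y_1y_2\cdots y_n}=(\cdots((x\rhd y_1)\rhd y_2)\cdots)\rhd y_n$; $[13]^n$ is the word $13$ repeated $n$ times. The geodesic $g(x,y)$ is the subquandle generated by $x$ and $y$, its length is its number of elements, and a geodesic is maximal if it is not a proper subset of another geodesic. The involutory quandle $Q_2(L)$ of a link $L$ is generated by the arcs of a diagram of $L$, with the relation $u\rhd o=v$ at each crossing with overcrossing arc $o$ and undercrossing arcs $u$, $v$. Let $p,q,e$ be integers with $0<p<q$ and $\gcd(p,q)=1$, let $w=(e-1)q-p$, and let $L=L(1/2,1/2,p/q;e)$ be the $(2,2,r)$-Montesinos link: $e$ right-handed half-twists and the rational tangles $1/2$, $1/2$, $p/q$, arranged cyclically in this order, where replacing a fraction $r$ by $r+1$ and $e$ by $e+1$ does not change the link. Position the tangles in a row from left to right, the crossings of the tangles $1/2$ being placed one above the other with overstrands running from lower left to upper right. Let $1$ and $2$ be the arcs at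 the lower left and the lower right corner of the first tangle $1/2$, and let $3$ be the arc at the upper right corner of the second tangle $1/2$; these generate $Q_2(L)$ (and $2^1=2^3$). Let $\mathcal C_i$ be the component containing $i$ of the Cayley graph of $Q_2(L)$, whose edges join $x$ to $x^{g}$ for $x\in Q_2(L)$ and $g\in\{1,2,3\}$. **Theorem.** $Q_2(L)$ has exactly $q+1$ maximal geodesics. (a) If $q$ is odd, one of them is $g(1,1^{32})$; it has length $2q|w|$ and is equal to $\mathcal C_1$. The remaining $q$ maximal geodesics are $g(2,3),\ g(2,3^{1}),\ g(2,3^{13}),\ g(2,3^{131}),\ \dots,\ g(2,3^{[13]^{(q-1)/2}})$, where the exponents are the first $k$ letters of $1313\cdots$ for $0\le k\le q-1$; these are pairwise distinct, each has length $4|w|$, and the intersection of any two of them is $\mathcal C_2$. (b) If $q$ is even, one of them is $g(1,3^{2})$; it has length $2q|w|$ and is equal to $\mathcal C_1\cup\mathcal C_3$. The remaining $q$ maximal geodesics are the first $q$ members of the list $g(2,1),\ g(2,3),\ g(2,1^{3}),\ g(2,3^{1}),\ g(2,1^{31}),\ g(2,3^{13}),\ \dots$, that is, $g(2,1^{u})$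 and $g(2,3^{v})$, where $u$ and $v$ are the first $k$ letters of $3131\cdots$ and of $1313\cdots$, respectively, for $0\le k\le q/2-1$; these are pairwise distinct, each has length $4|w|$, and the intersection of any two of them is $\mathcal C_2$. -/

import Mathlib

open scoped Quandles

/-! ## Geodesics and Cayley graphs in quandles

In the convention used here, `b ◃ a` is the element `a ▷ b = a ^ b` (`b` acts on `a`). -/

section Quandle

variable {Q : Type} [Quandle Q]

/-- `S` is closed under the quandle operation and its inverse. -/
def IsSubquandle (S : Set Q) : Prop :=
  ∀ a ∈ S, ∀ b ∈ S, b ◃ a ∈ S ∧ b ◃⁻¹ a ∈ S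

/-- The geodesic `g(x, y)`: the subquandle generated by `x` and `y`. -/
def geodesic (x y : Q) : Set Q :=
  ⋂₀ {S | IsSubquandle S ∧ x ∈ S ∧ y ∈ S}

/-- A geodesic that is not a proper subset of another geodesic. -/
def IsMaximalGeodesic (G : Set Q) : Prop :=
  (∃ x y : Q, G = geodesic x y) ∧ ∀ x y : Q, ¬ G ⊂ geodesic x y

/-- `x ^ (y₁ y₂ ⋯ yₙ) = (⋯((x ▷ y₁) ▷ y₂) ⋯) ▷ yₙ`. -/
def wordAct (x : Q) (l : List Q) : Q :=
  l.foldl (fun a g => g ◃ a) x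

/-- The first `k` letters of the word `a b a b a b ⋯`. -/
def altWord (a b : Q) : ℕ → List Q
  | 0 => []
  | k + 1 => a :: altWord b a k

/-- The Cayley graph of a quandle with respect to a set of generators: `a` is joined to `a ▷ g` for
every generator `g` (labels and loops, which do not influence the components, are omitted). -/
def cayleyGraph (gens : Set Q) : SimpleGraph Q :=
  SimpleGraph.fromRel fun a b => ∃ g ∈ gens, b = g ◃ a

/-- The set of vertices of the component of the Cayley graph which contains `x`. -/
def cayleyComponent (gens : Set Q) (x : Q) : Set Q :=
  ((cayleyGraph gens).connectedComponentMk x).supp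

end Quandle

/-! ## Presented involutory quandles -/

section Presented

variable {X : Type}

/-- The smallest congruence on formal products `a * b` (to be read as `a ▷ b`) of generators which
contains the relations `r` and forces the axioms of an involutory quandle. -/
inductive InvQuandleCon (r : FreeMagma X → FreeMagma X → Prop) :
    FreeMagma X → FreeMagma X → Prop
  | rel {a b} : r a b → InvQuandleCon r a b
  | refl (a) : InvQuandleCon r a a
  | symm {a b} : InvQuandleCon r a b → InvQuandleCon r b a
  | trans {a b c} : InvQuandleCon r a b → InvQuandleCon r b c → InvQuandleCon r a c
  | mul {a a' b b'} : InvQuandleCon r a a' → InvQuandleCon r b b' →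
      InvQuandleCon r (a * b) (a' * b')
  | idem (a) : InvQuandleCon r (a * a) a
  | invol (a b) : InvQuandleCon r (a * b * b) a
  | distrib (a b c) : InvQuandleCon r (a * b * c) (a * c * (b * c))

/-- The congruence as a setoid. -/
def invQuandleSetoid (r : FreeMagma X → FreeMagma X → Prop) : Setoid (FreeMagma X) where
  r := InvQuandleCon r
  iseqv := ⟨InvQuandleCon.refl, InvQuandleCon.symm, InvQuandleCon.trans⟩

/-- The involutory quandle `⟨X | r⟩`. -/
def PresentedInvQuandle (r : FreeMagma X → FreeMagma X → Prop) : Type :=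
  Quotient (invQuandleSetoid r)

namespace PresentedInvQuandle

variable {r : FreeMagma X → FreeMagma X → Prop}

/-- The element of `⟨X | r⟩` given by the generator `x`. -/
def of (r : FreeMagma X → FreeMagma X → Prop) (x : X) : PresentedInvQuandle r :=
  Quotient.mk (invQuandleSetoid r) (FreeMagma.of x)

/-- `act b a = a ▷ b`. -/
def act (b a : PresentedInvQuandle r) : PresentedInvQuandle r :=
  Quotient.map₂ (sa := invQuandleSetoid r) (sb := invQuandleSetoid r) (sc := invQuandleSetoid r)
    (fun s t : FreeMagma X => s * t)
    (fun _ _ h _ _ h' => InvQuandleCon.mul h h') a b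

theorem act_act (b a : PresentedInvQuandle r) : act b (act b a) = a := by
  induction a using Quotient.inductionOn with | _ a
  induction b using Quotient.inductionOn with | _ b
  exact Quotient.sound (InvQuandleCon.invol a b)

instance : Quandle (PresentedInvQuandle r) where
  act := act
  invAct := act
  self_distrib := by
    intro x y z
    induction x using Quotient.inductionOn with | _ x
    induction y using Quotient.inductionOn with | _ y
    induction z using Quotient.inductionOn with | _ z
    exact Quotient.sound (InvQuandleCon.distrib z y x)
  left_inv := fun b a => act_act b a
  right_inv := fun b a => act_act b a
  fix := by
    intro x
    induction x using Quotient.inductionOn with | _ x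
    exact Quotient.sound (InvQuandleCon.idem x)

end PresentedInvQuandle

end Presented

/-! ## Tangle diagrams and link diagrams -/

/-- Diagrams of algebraic (arborescent) tangles, with four endpoints NW, NE, SW, SE.
* `zero`: two horizontal arcs, `infinity`: two vertical arcs;
* `pos`: one crossing with overstrand from SW to NE, `neg`: one with overstrand from NW to SE;
* `hsum S T`: `S` to the left of `T`, where NE, SE of `S` are joined to NW, SW of `T`;
* `vsum S T`: `S` above `T`, where SW, SE of `S` are joined to NW, NE of `T`. -/
inductive TangleDiagram : Type
  | zero
  | infinity
  | pos
  | neg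
  | hsum (S T : TangleDiagram)
  | vsum (S T : TangleDiagram)

namespace TangleDiagram

/-- The pieces of arcs of a diagram. In `zero`: `0` top, `1` bottom. In `infinity`: `0` left,
`1` right. In `pos`, `neg`: `0` is the overstrand, `1` and `2` are the upper and lower halves of the
understrand. -/
def Edge : TangleDiagram → Type
  | zero => Fin 2
  | infinity => Fin 2
  | pos => Fin 3
  | neg => Fin 3
  | hsum S T => S.Edge ⊕ T.Edge
  | vsum S T => S.Edge ⊕ T.Edge

/-- The piece of arc that ends at the corner NW. -/
def nw : (T : TangleDiagram) → T.Edge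
  | zero => (0 : Fin 2)
  | infinity => (0 : Fin 2)
  | pos => (1 : Fin 3)
  | neg => (0 : Fin 3)
  | hsum S _ => Sum.inl S.nw
  | vsum S _ => Sum.inl S.nw

/-- The piece of arc that ends at the corner NE. -/
def ne : (T : TangleDiagram) → T.Edge
  | zero => (0 : Fin 2)
  | infinity => (1 : Fin 2)
  | pos => (0 : Fin 3)
  | neg => (1 : Fin 3)
  | hsum _ T => Sum.inr T.ne
  | vsum S _ => Sum.inl S.ne

/-- The piece of arc that ends at the corner SW. -/
def sw : (T : TangleDiagram) → T.Edge
  | zero => (1 : Fin 2)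
  | infinity => (0 : Fin 2)
  | pos => (0 : Fin 3)
  | neg => (2 : Fin 3)
  | hsum S _ => Sum.inl S.sw
  | vsum _ T => Sum.inr T.sw

/-- The piece of arc that ends at the corner SE. -/
def se : (T : TangleDiagram) → T.Edge
  | zero => (1 : Fin 2)
  | infinity => (1 : Fin 2)
  | pos => (2 : Fin 3)
  | neg => (0 : Fin 3)
  | hsum _ T => Sum.inr T.se
  | vsum _ T => Sum.inr T.se

/-- `T.IsCrossing u o v`: at some crossing of `T`, the understrand consists of the pieces `u`, `v`,
and the overstrand is `o`. -/
def IsCrossing : (T : TangleDiagram) → T.Edge → T.Edge → T.Edge → Prop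
  | zero, _, _, _ => False
  | infinity, _, _, _ => False
  | pos, u, o, v => u = (1 : Fin 3) ∧ o = (0 : Fin 3) ∧ v = (2 : Fin 3)
  | neg, u, o, v => u = (1 : Fin 3) ∧ o = (0 : Fin 3) ∧ v = (2 : Fin 3)
  | hsum S T, u, o, v =>
      (∃ u' o' v', S.IsCrossing u' o' v' ∧ u = Sum.inl u' ∧ o = Sum.inl o' ∧ v = Sum.inl v') ∨
      (∃ u' o' v', T.IsCrossing u' o' v' ∧ u = Sum.inr u' ∧ o = Sum.inr o' ∧ v = Sum.inr v')
  | vsum S T, u, o, v =>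
      (∃ u' o' v', S.IsCrossing u' o' v' ∧ u = Sum.inl u' ∧ o = Sum.inl o' ∧ v = Sum.inl v') ∨
      (∃ u' o' v', T.IsCrossing u' o' v' ∧ u = Sum.inr u' ∧ o = Sum.inr o' ∧ v = Sum.inr v')

/-- `T.IsJoined a b`: the pieces `a`, `b` were joined end to end when tangles were added. -/
def IsJoined : (T : TangleDiagram) → T.Edge → T.Edge → Prop
  | zero, _, _ => False
  | infinity, _, _ => False
  | pos, _, _ => False
  | neg, _, _ => False
  | hsum S T, a, b =>
      (∃ a' b', S.IsJoined a' b' ∧ a = Sum.inl a' ∧ b = Sum.inl b') ∨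
      (∃ a' b', T.IsJoined a' b' ∧ a = Sum.inr a' ∧ b = Sum.inr b') ∨
      (a = Sum.inl S.ne ∧ b = Sum.inr T.nw) ∨ (a = Sum.inl S.se ∧ b = Sum.inr T.sw)
  | vsum S T, a, b =>
      (∃ a' b', S.IsJoined a' b' ∧ a = Sum.inl a' ∧ b = Sum.inl b') ∨
      (∃ a' b', T.IsJoined a' b' ∧ a = Sum.inr a' ∧ b = Sum.inr b') ∨
      (a = Sum.inl S.sw ∧ b = Sum.inr T.nw) ∨ (a = Sum.inl S.se ∧ b = Sum.inr T.ne)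

/-- The Wirtinger relations of the link diagram obtained from `T` by joining NW to NE and SW to SE
(numerator closure): `u ▷ o = v` at every crossing, and pieces joined end to end are equal. -/
inductive WirtingerRel (T : TangleDiagram) : FreeMagma T.Edge → FreeMagma T.Edge → Prop
  | crossing {u o v : T.Edge} : T.IsCrossing u o v →
      WirtingerRel T (FreeMagma.of u * FreeMagma.of o) (FreeMagma.of v)
  | joined {a b : T.Edge} : T.IsJoined a b → WirtingerRel T (FreeMagma.of a) (FreeMagma.of b)
  | top : WirtingerRel T (FreeMagma.of T.nw) (FreeMagma.of T.ne)
  | bottom : WirtingerRel T (FreeMagma.of T.sw) (FreeMagma.of T.se)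

/-- The involutory quandle `Q₂` of the link given by the numerator closure of `T`. -/
abbrev ClosureQuandle (T : TangleDiagram) : Type := PresentedInvQuandle T.WirtingerRel

/-- A row of `n` copies of the one-crossing diagram `c`. -/
def row (c : TangleDiagram) : ℕ → TangleDiagram
  | 0 => zero
  | n + 1 => hsum (row c n) c

/-- `e` horizontal half-twists: for `e > 0` the overstrands run from NW to SE. -/
def twists : ℤ → TangleDiagram
  | Int.ofNat n => row neg n
  | Int.negSucc n => row pos (n + 1)

/-- The rational tangle with fraction `p / q`, `p, q ≥ 0`, built along the subtractive Euclidean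
algorithm: adding a crossing on the right adds `1` to the fraction, adding a crossing at the bottom
adds `1` to its reciprocal. -/
def rational (p q : ℕ) : TangleDiagram :=
  if q = 0 then infinity
  else if p = 0 then zero
  else if p < q then vsum (rational p (q - p)) pos
  else hsum (rational (p - q) q) pos
termination_by p + q

end TangleDiagram

/-! ## The links `L(1/2, 1/2, p/q; e)` -/

open TangleDiagram in
/-- The Montesinos link `L(p₁/q₁, p₂/q₂, p₃/q₃; e)` is the numerator closure of this tangle: a row
of `e` half-twists followed by the three rational tangles. -/
def montesinosTangle (p₁ q₁ p₂ q₂ p₃ q₃ : ℕ) (e : ℤ) : TangleDiagram :=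
  hsum (hsum (hsum (twists e) (rational p₁ q₁)) (rational p₂ q₂)) (rational p₃ q₃)

namespace Link22

/-- The involutory quandle of `L(1/2, 1/2, p/q; e)`. -/
abbrev Q₂ (p q : ℕ) (e : ℤ) : Type := (montesinosTangle 1 2 1 2 p q e).ClosureQuandle

/-- The generator `1`: the arc at the corner SW of the first tangle `1/2`. -/
def gen₁ (p q : ℕ) (e : ℤ) : Q₂ p q e :=
  PresentedInvQuandle.of (montesinosTangle 1 2 1 2 p q e).WirtingerRel
    (Sum.inl (Sum.inl (Sum.inr (TangleDiagram.rational 1 2).sw)))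

/-- The generator `2`: the arc at the corner SE of the first tangle `1/2`. -/
def gen₂ (p q : ℕ) (e : ℤ) : Q₂ p q e :=
  PresentedInvQuandle.of (montesinosTangle 1 2 1 2 p q e).WirtingerRel
    (Sum.inl (Sum.inl (Sum.inr (TangleDiagram.rational 1 2).se)))

/-- The generator `3`: the arc at the corner NE of the second tangle `1/2`. -/
def gen₃ (p q : ℕ) (e : ℤ) : Q₂ p q e :=
  PresentedInvQuandle.of (montesinosTangle 1 2 1 2 p q e).WirtingerRel
    (Sum.inl (Sum.inr (TangleDiagram.rational 1 2).ne))

/-- The components `C₁`, `C₂`, `C₃` of the Cayley graph with respect to `1`, `2`, `3`: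
the component which contains `x`. -/
def component (p q : ℕ) (e : ℤ) (x : Q₂ p q e) : Set (Q₂ p q e) :=
  cayleyComponent {gen₁ p q e, gen₂ p q e, gen₃ p q e} x

/-- For odd `q`, the long geodesic `g(1, 1^{32})`; for even `q`, the long geodesic `g(1, 3^2)`. -/
def longGeodesic (p q : ℕ) (e : ℤ) : Set (Q₂ p q e) :=
  if Odd q then geodesic (gen₁ p q e) (wordAct (gen₁ p q e) [gen₃ p q e, gen₂ p q e])
  else geodesic (gen₁ p q e) (wordAct (gen₃ p q e) [gen₂ p q e])

/-- The short geodesics with their index `k < q`. For odd `q` they are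
`g(2, 3)`, `g(2, 3^1)`, `g(2, 3^{13})`, `g(2, 3^{131})`, …, `g(2, 3^{[13]^{(q-1)/2}})`;
for even `q` they are
`g(2, 1)`, `g(2, 3)`, `g(2, 1^3)`, `g(2, 3^1)`, `g(2, 1^{31})`, `g(2, 3^{13})`, …. -/
def shortGeodesic (p q : ℕ) (e : ℤ) (k : ℕ) : Set (Q₂ p q e) :=
  if Odd q then
    geodesic (gen₂ p q e) (wordAct (gen₃ p q e) (altWord (gen₁ p q e) (gen₃ p q e) k))
  else if Even k then
    geodesic (gen₂ p q e) (wordAct (gen₁ p q e) (altWord (gen₃ p q e) (gen₁ p q e) (k / 2)))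
  else
    geodesic (gen₂ p q e) (wordAct (gen₃ p q e) (altWord (gen₁ p q e) (gen₃ p q e) (k / 2)))

end Link22

/-! ## Geodesic sequences -/

/-! The quandle is computed completely: it is a disjoint union of two dihedral quandles, `x` indexed
by integers modulo `2 * q * w` and `y` indexed by integers modulo `2 * w`, with arc `1` at `x 0`,
arc `2` at `y 0` and arc `3` at `x (-w)` (`IsParametrization`,
`TangleDiagram.exists_parametrization`).

The upper bound comes from rational tangles: all arcs of one lie on a single geodesic sequence, at
positions found by the Euclidean algorithm (`exists_isUniversalColoring_rational`). Gluing the four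
tangles makes the twists a progression of step `q` in the sequence `x` of the tangle `p / q`. The
sequences of the two tangles `1/2` share their even terms, which form `y`, and their odd terms are
progressions of step `q` in `x` through `0` and `-w`. This fixes how `x` and `y` act on each other
at the indices `w * n + q * m` (`IsDihedralPair.of_geodesicSeq`). Such an index does not determine
`n` and `m`, and this ambiguity forces the two periods. The lower bound is an explicit model with
exactly these periods, which satisfies the axioms and colours the diagram (`exists_hom_model`).

In coordinates, two terms of `x` lie in the range of `x`, and any other pair lies in the union of
all `y j` with one class modulo `q` of the `x i` (`shortSet`). These `1 + q` subquandles are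
geodesics, none contains another, and so they are the maximal ones. It remains to locate the listed
geodesics: the generators of the long one have an index difference prime to `2 * q * w`, and the
short ones contain `x (w * m)` for values of `m` that exhaust the residues modulo `q`
(`shortIndex_injOn`). -/

theorem Int.two_step_induction {P : ℤ → Prop} (s : ℤ) (h0 : P s) (h1 : P (s + 1))
    (up : ∀ n, P n → P (n + 1) → P (n + 2)) (down : ∀ n, P n → P (n + 1) → P (n - 1)) (n : ℤ) :
    P n := by
  have key : ∀ k : ℕ, (P (s + k) ∧ P (s + k + 1)) ∧ (P (s - k) ∧ P (s - k + 1)) := by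
    intro k
    induction k with
    | zero => simpa using ⟨h0, h1⟩
    | succ k ih =>
      obtain ⟨⟨a, b⟩, c, d⟩ := ih
      have e := up _ a b
      have f := down _ c d
      push_cast
      refine ⟨⟨?_, ?_⟩, ?_, ?_⟩
      · convert b using 1; ring
      · convert e using 1; ring
      · convert f using 1; ring
      · convert c using 1; ring
  rcases le_total s n with h | h
  · have := (key (n - s).toNat).1.1
    rwa [Int.toNat_of_nonneg (by omega), add_sub_cancel] at this
  · have := (key (s - n).toNat).2.1
    rwa [Int.toNat_of_nonneg (by omega), sub_sub_cancel] at this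

/-- `X` is a homomorphism from the infinite dihedral quandle, where `op b a` is `a ▷ b`. -/
def IsGeodesicSeq {α : Type} (op : α → α → α) (X : ℤ → α) : Prop :=
  ∀ i j, X (2 * j - i) = op (X j) (X i)

namespace IsGeodesicSeq

variable {α β : Type} {op : α → α → α} {X X' : ℤ → α}

theorem affine (h : IsGeodesicSeq op X) (a b : ℤ) : IsGeodesicSeq op fun i => X (a * i + b) := by
  intro i j
  simp only [← h (a * i + b) (a * j + b)]
  congr 1; ring

theorem comp (h : IsGeodesicSeq op X) {op' : β → β → β} {φ : α → β}
    (hφ : ∀ a b, φ (op b a) = op' (φ b) (φ a)) : IsGeodesicSeq op' fun i => φ (X i) := by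
  intro i j
  simp only [h i j, hφ]

/-- Each term is the reflection of the term two places away in the one between them, so two
neighbouring terms determine the sequence. -/
theorem unique (h : IsGeodesicSeq op X) (h' : IsGeodesicSeq op X') (s : ℤ) (h0 : X s = X' s)
    (h1 : X (s + 1) = X' (s + 1)) (n : ℤ) : X n = X' n := by
  refine Int.two_step_induction (P := fun n => X n = X' n) s h0 h1 ?_ ?_ n
  · intro n a b
    have e : n + 2 = 2 * (n + 1) - n := by ring
    rw [e, h, h', a, b]
  · intro n a b
    have e : n - 1 = 2 * n - (n + 1) := by ring
    rw [e, h, h', a, b]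

end IsGeodesicSeq

/-- In an involutory quandle any two elements are neighbours in a geodesic sequence. -/
theorem exists_isGeodesicSeq {Q : Type} [Quandle Q] (hinv : ∀ a b : Q, b ◃ b ◃ a = a) (x y : Q) :
    ∃ X : ℤ → Q, IsGeodesicSeq (fun b a => b ◃ a) X ∧ X 0 = x ∧ X (-1) = y := by
  set a : Equiv.Perm Q := Rack.act' x with ha
  set b : Equiv.Perm Q := Rack.act' y with hb
  have haa : a * a = 1 := by ext z; simpa [ha] using hinv z x
  have hbb : b * b = 1 := by ext z; simpa [hb] using hinv z y
  set T : Equiv.Perm Q := a * b with hT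
  have hai : a⁻¹ = a := inv_eq_of_mul_eq_one_left haa
  have hbi : b⁻¹ = b := inv_eq_of_mul_eq_one_left hbb
  have hTi : T⁻¹ = b * a := by rw [hT, mul_inv_rev, hai, hbi]
  have haT : ∀ k : ℤ, a * T ^ k = T ^ (-k) * a := by
    intro k
    have h1 : a * T * a⁻¹ = T⁻¹ := by
      rw [hTi, hT, ← mul_assoc, haa, one_mul, hai]
    have h2 : a * T ^ k * a⁻¹ = T ^ (-k) := by
      rw [← conj_zpow, h1, inv_zpow, zpow_neg]
    rw [← h2]; simp
  have had : ∀ (k : ℤ) (z : Q), Rack.act' ((T ^ k) z) = T ^ k * Rack.act' z * (T ^ k)⁻¹ := by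
    have h1 : ∀ z, Rack.act' (T z) = T * Rack.act' z * T⁻¹ := by
      intro z
      have : T z = x ◃ (y ◃ z) := rfl
      rw [this, Rack.ad_conj, Rack.ad_conj, hT, mul_inv_rev]
      simp only [mul_assoc, ha, hb]
    have h2 : ∀ z, Rack.act' (T⁻¹ z) = T⁻¹ * Rack.act' z * T := by
      intro z
      have h3 : Rack.act' z = T * Rack.act' (T⁻¹ z) * T⁻¹ := by
        rw [← h1]; exact congrArg _ (T.apply_symm_apply z).symm
      rw [h3]; group
    intro k
    induction k using Int.induction_on with
    | zero => simp
    | succ k ih =>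
      intro z
      rw [zpow_add_one, Equiv.Perm.mul_apply, ih, h1]; group
    | pred k ih =>
      intro z
      rw [zpow_sub_one, Equiv.Perm.mul_apply, ih, h2]; group
  have hbT : b = T⁻¹ * a := by rw [hTi, mul_assoc, haa, mul_one]
  have hTconj : ∀ k : ℤ, T ^ k * a * (T ^ k)⁻¹ = T ^ (2 * k) * a := by
    intro k
    rw [mul_assoc, ← zpow_neg, haT, neg_neg, ← mul_assoc, ← zpow_add, two_mul]
  have hax : a x = x := Quandle.fix
  have hay : a y = T y := by
    have : b y = y := Quandle.fix
    rw [hT, Equiv.Perm.mul_apply, this]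
  let X : ℤ → Q := fun i => if Even i then (T ^ (i / 2)) x else (T ^ ((i + 1) / 2)) y
  have Xe : ∀ k : ℤ, X (2 * k) = (T ^ k) x := by
    intro k
    simp only [X, even_two_mul, if_true]
    congr 2; omega
  have Xo : ∀ k : ℤ, X (2 * k - 1) = (T ^ k) y := by
    intro k
    have : ¬ Even (2 * k - 1) := by rw [Int.not_even_iff_odd]; exact ⟨k - 1, by ring⟩
    simp only [X, this, if_false]
    congr 2; omega
  -- The reflection `i ↦ 2 * j - i` is the reflection in `0` followed by translation by `2 * j`.
  have hR : ∀ j, Rack.act' (X j) = T ^ j * a := by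
    intro j
    rcases Int.even_or_odd' j with ⟨k, rfl | rfl⟩
    · rw [Xe, had, ← ha, hTconj]
    · rw [show 2 * k + 1 = 2 * (k + 1) - 1 by ring, Xo, had, ← hb, hbT, ← mul_assoc,
        ← zpow_sub_one, zpow_sub_one, ← (Commute.self_zpow T (k + 1)).inv_left.eq, mul_assoc,
        mul_assoc, ← mul_assoc _ a, hTconj, ← mul_assoc, zpow_sub_one,
        ((Commute.self_zpow T (2 * (k + 1))).inv_left).eq]
  refine ⟨X, ?_, ?_, ?_⟩
  · intro i j
    have : X j ◃ X i = (T ^ j * a) (X i) := by rw [← hR]; rfl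
    simp only [this]
    rcases Int.even_or_odd' i with ⟨k, rfl | rfl⟩
    · rw [show 2 * j - 2 * k = 2 * (j - k) by ring, Xe, Xe, ← Equiv.Perm.mul_apply, mul_assoc, haT,
        ← mul_assoc, ← zpow_add, Equiv.Perm.mul_apply, hax, sub_eq_add_neg]
    · rw [show 2 * k + 1 = 2 * (k + 1) - 1 by ring,
        show 2 * j - (2 * (k + 1) - 1) = 2 * (j + -(k + 1) + 1) - 1 by ring, Xo, Xo,
        ← Equiv.Perm.mul_apply, mul_assoc, haT, ← mul_assoc, ← zpow_add, Equiv.Perm.mul_apply, hay,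
        ← Equiv.Perm.mul_apply, ← zpow_add_one]
  · simpa using Xe 0
  · simpa using Xo 0

/-! ## Colourings of tangles -/

namespace TangleDiagram

/-- `f` satisfies the Wirtinger relations of `T`, where `op b a` is `a ▷ b`. -/
def IsColoring {α : Type} (op : α → α → α) (T : TangleDiagram) (f : T.Edge → α) : Prop :=
  (∀ u o v, T.IsCrossing u o v → f v = op (f o) (f u)) ∧ ∀ a b, T.IsJoined a b → f a = f b

/-- `c` is the universal colouring of the arcs of `T` by integers: every colouring by an involutory
quandle factors through it. The differences `NW - SW` and `NW - NE` are `h` and `v`. -/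
structure IsUniversalColoring (T : TangleDiagram) (h v : ℤ) (c : T.Edge → ℤ) : Prop where
  isColoring : T.IsColoring (fun j i => 2 * j - i) c
  nw : c T.nw = 0
  sw : c T.sw = -h
  ne : c T.ne = -v
  se : c T.se = -v - h
  adjacent : ∃ a b, c b = c a + 1
  factor : ∀ (Q : Type) [Quandle Q] (_ : ∀ a b : Q, b ◃ b ◃ a = a) (f : T.Edge → Q),
    T.IsColoring (fun b a => b ◃ a) f →
      ∃ X : ℤ → Q, IsGeodesicSeq (fun b a => b ◃ a) X ∧ ∀ a, f a = X (c a)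

theorem IsColoring.hsum_left {α : Type} {op : α → α → α} {S T : TangleDiagram}
    {f : (hsum S T).Edge → α} (h : (hsum S T).IsColoring op f) :
    S.IsColoring op fun a => f (Sum.inl a) :=
  ⟨fun u o v huv => h.1 _ _ _ (Or.inl ⟨u, o, v, huv, rfl, rfl, rfl⟩),
    fun a b hab => h.2 _ _ (Or.inl ⟨a, b, hab, rfl, rfl⟩)⟩

theorem IsColoring.hsum_right {α : Type} {op : α → α → α} {S T : TangleDiagram}
    {f : (hsum S T).Edge → α} (h : (hsum S T).IsColoring op f) :
    T.IsColoring op fun a => f (Sum.inr a) :=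
  ⟨fun u o v huv => h.1 _ _ _ (Or.inr ⟨u, o, v, huv, rfl, rfl, rfl⟩),
    fun a b hab => h.2 _ _ (Or.inr (Or.inl ⟨a, b, hab, rfl, rfl⟩))⟩

theorem IsColoring.hsum_top {α : Type} {op : α → α → α} {S T : TangleDiagram}
    {f : (hsum S T).Edge → α} (h : (hsum S T).IsColoring op f) :
    f (Sum.inl S.ne) = f (Sum.inr T.nw) :=
  h.2 _ _ (Or.inr (Or.inr (Or.inl ⟨rfl, rfl⟩)))

theorem IsColoring.hsum_bottom {α : Type} {op : α → α → α} {S T : TangleDiagram}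
    {f : (hsum S T).Edge → α} (h : (hsum S T).IsColoring op f) :
    f (Sum.inl S.se) = f (Sum.inr T.sw) :=
  h.2 _ _ (Or.inr (Or.inr (Or.inr ⟨rfl, rfl⟩)))

theorem IsColoring.hsum {α : Type} {op : α → α → α} {S T : TangleDiagram} {f : S.Edge → α}
    {g : T.Edge → α} (hf : S.IsColoring op f) (hg : T.IsColoring op g) (ht : f S.ne = g T.nw)
    (hb : f S.se = g T.sw) : (hsum S T).IsColoring op (Sum.elim f g) := by
  constructor
  · rintro u o v (⟨u', o', v', h, rfl, rfl, rfl⟩ | ⟨u', o', v', h, rfl, rfl, rfl⟩)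
    · exact hf.1 _ _ _ h
    · exact hg.1 _ _ _ h
  · rintro a b (⟨a', b', h, rfl, rfl⟩ | ⟨a', b', h, rfl, rfl⟩ | ⟨rfl, rfl⟩ | ⟨rfl, rfl⟩)
    · exact hf.2 _ _ h
    · exact hg.2 _ _ h
    · exact ht
    · exact hb

theorem IsColoring.vsum_top {α : Type} {op : α → α → α} {S T : TangleDiagram}
    {f : (vsum S T).Edge → α} (h : (vsum S T).IsColoring op f) :
    S.IsColoring op fun a => f (Sum.inl a) :=
  ⟨fun u o v huv => h.1 _ _ _ (Or.inl ⟨u, o, v, huv, rfl, rfl, rfl⟩),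
    fun a b hab => h.2 _ _ (Or.inl ⟨a, b, hab, rfl, rfl⟩)⟩

theorem IsColoring.vsum {α : Type} {op : α → α → α} {S T : TangleDiagram} {f : S.Edge → α}
    {g : T.Edge → α} (hf : S.IsColoring op f) (hg : T.IsColoring op g) (ht : f S.sw = g T.nw)
    (hb : f S.se = g T.ne) : (vsum S T).IsColoring op (Sum.elim f g) := by
  constructor
  · rintro u o v (⟨u', o', v', h, rfl, rfl, rfl⟩ | ⟨u', o', v', h, rfl, rfl, rfl⟩)
    · exact hf.1 _ _ _ h
    · exact hg.1 _ _ _ h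
  · rintro a b (⟨a', b', h, rfl, rfl⟩ | ⟨a', b', h, rfl, rfl⟩ | ⟨rfl, rfl⟩ | ⟨rfl, rfl⟩)
    · exact hf.2 _ _ h
    · exact hg.2 _ _ h
    · exact ht
    · exact hb

/-- The colouring of a single crossing by an overstrand `o` and an understrand `u`, `v`. -/
def crossingColor {α : Type} (o u v : α) : Fin 3 → α := ![o, u, v]

theorem isColoring_pos {α : Type} {op : α → α → α} {o u v : α} (h : v = op o u) :
    pos.IsColoring op (crossingColor o u v) := by
  refine ⟨?_, fun _ _ h => h.elim⟩
  rintro _ _ _ ⟨rfl, rfl, rfl⟩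
  exact h

theorem isColoring_neg {α : Type} {op : α → α → α} {o u v : α} (h : v = op o u) :
    neg.IsColoring op (crossingColor o u v) := by
  refine ⟨?_, fun _ _ h => h.elim⟩
  rintro _ _ _ ⟨rfl, rfl, rfl⟩
  exact h

/-- Two unrelated arcs may take any two values, and `exists_isGeodesicSeq` puts these on a geodesic
sequence as neighbours. -/
theorem exists_isUniversalColoring_zero : ∃ c, zero.IsUniversalColoring 1 0 c := by
  refine ⟨(![0, -1] : Fin 2 → ℤ), ⟨fun _ _ _ h => h.elim, fun _ _ h => h.elim⟩, rfl, rfl, rfl, rfl,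
    ⟨(1 : Fin 2), (0 : Fin 2), rfl⟩, ?_⟩
  intro Q _ hinv f _
  obtain ⟨X, hX, h0, h1⟩ := exists_isGeodesicSeq hinv (f (0 : Fin 2)) (f (1 : Fin 2))
  refine ⟨X, hX, fun a => ?_⟩
  change Fin 2 at a
  fin_cases a
  · exact h0.symm
  · exact h1.symm

/-- An added crossing has one new arc, whose value is forced by reflection, and imposes no relation
on the old arcs; so the same geodesic sequence still serves. -/
theorem exists_isUniversalColoring_hsum_pos {T : TangleDiagram} {h v : ℤ}
    (hT : ∃ c, T.IsUniversalColoring h v c) :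
    ∃ c, (hsum T pos).IsUniversalColoring h (v + h) c := by
  obtain ⟨c, hc⟩ := hT
  refine ⟨Sum.elim c (crossingColor (-v - h) (-v) (-v - 2 * h)), ?_, hc.nw, hc.sw, ?_, ?_, ?_, ?_⟩
  · exact hc.isColoring.hsum (isColoring_pos (by ring)) hc.ne hc.se
  · change -v - h = _; ring
  · change -v - 2 * h = _; ring
  · obtain ⟨a, b, hab⟩ := hc.adjacent
    exact ⟨Sum.inl a, Sum.inl b, hab⟩
  · intro Q _ hinv f hf
    obtain ⟨X, hX, hfX⟩ := hc.factor Q hinv _ hf.hsum_left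
    have h1 : f (Sum.inr (1 : Fin 3)) = X (-v) := by
      rw [← hc.ne, ← hfX]; exact hf.hsum_top.symm
    have h0 : f (Sum.inr (0 : Fin 3)) = X (-v - h) := by
      rw [← hc.se, ← hfX]; exact hf.hsum_bottom.symm
    have h2 : f (Sum.inr (2 : Fin 3)) = X (-v - 2 * h) := by
      have := hf.hsum_right.1 (1 : Fin 3) (0 : Fin 3) (2 : Fin 3) ⟨rfl, rfl, rfl⟩
      simp only at this
      rw [this, h0, h1, show -v - 2 * h = 2 * (-v - h) - (-v) by ring, hX]
    refine ⟨X, hX, ?_⟩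
    rintro (a | a)
    · exact hfX a
    · change Fin 3 at a
      fin_cases a
      · exact h0
      · exact h1
      · exact h2

theorem exists_isUniversalColoring_hsum_neg {T : TangleDiagram} {h v : ℤ}
    (hT : ∃ c, T.IsUniversalColoring h v c) :
    ∃ c, (hsum T neg).IsUniversalColoring h (v - h) c := by
  obtain ⟨c, hc⟩ := hT
  refine ⟨Sum.elim c (crossingColor (-v) (-v + h) (-v - h)), ?_, hc.nw, hc.sw, ?_, ?_, ?_, ?_⟩
  · exact hc.isColoring.hsum (isColoring_neg (by ring)) hc.ne hc.se
  · change -v + h = _; ring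
  · change -v = _; ring
  · obtain ⟨a, b, hab⟩ := hc.adjacent
    exact ⟨Sum.inl a, Sum.inl b, hab⟩
  · intro Q _ hinv f hf
    obtain ⟨X, hX, hfX⟩ := hc.factor Q hinv _ hf.hsum_left
    have h0 : f (Sum.inr (0 : Fin 3)) = X (-v) := by
      rw [← hc.ne, ← hfX]; exact hf.hsum_top.symm
    have h2 : f (Sum.inr (2 : Fin 3)) = X (-v - h) := by
      rw [← hc.se, ← hfX]; exact hf.hsum_bottom.symm
    have h1 : f (Sum.inr (1 : Fin 3)) = X (-v + h) := by
      have := hf.hsum_right.1 (1 : Fin 3) (0 : Fin 3) (2 : Fin 3) ⟨rfl, rfl, rfl⟩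
      simp only at this
      rw [h0, h2] at this
      -- Here the new arc is the undercrossing piece `u` of the relation, so the relation is solved
      -- for it by involutivity.
      rw [show -v + h = 2 * (-v) - (-v - h) by ring, hX, this]
      exact (hinv _ _).symm
    refine ⟨X, hX, ?_⟩
    rintro (a | a)
    · exact hfX a
    · change Fin 3 at a
      fin_cases a
      · exact h0
      · exact h1
      · exact h2

theorem exists_isUniversalColoring_vsum_pos {T : TangleDiagram} {h v : ℤ}
    (hT : ∃ c, T.IsUniversalColoring h v c) :
    ∃ c, (vsum T pos).IsUniversalColoring (h + v) v c := by
  obtain ⟨c, hc⟩ := hT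
  refine ⟨Sum.elim c (crossingColor (-v - h) (-h) (-2 * v - h)), ?_, hc.nw, ?_, hc.ne, ?_, ?_, ?_⟩
  · exact hc.isColoring.vsum (isColoring_pos (by ring)) hc.sw hc.se
  · change -v - h = _; ring
  · change -2 * v - h = _; ring
  · obtain ⟨a, b, hab⟩ := hc.adjacent
    exact ⟨Sum.inl a, Sum.inl b, hab⟩
  · intro Q _ hinv f hf
    obtain ⟨X, hX, hfX⟩ := hc.factor Q hinv _ hf.vsum_top
    have h1 : f (Sum.inr (1 : Fin 3)) = X (-h) := by
      rw [← hc.sw, ← hfX]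
      exact (hf.2 (Sum.inl T.sw) (Sum.inr pos.nw) (Or.inr (Or.inr (Or.inl ⟨rfl, rfl⟩)))).symm
    have h0 : f (Sum.inr (0 : Fin 3)) = X (-v - h) := by
      rw [← hc.se, ← hfX]
      exact (hf.2 (Sum.inl T.se) (Sum.inr pos.ne) (Or.inr (Or.inr (Or.inr ⟨rfl, rfl⟩)))).symm
    have h2 : f (Sum.inr (2 : Fin 3)) = X (-2 * v - h) := by
      have := hf.1 (Sum.inr (1 : Fin 3)) (Sum.inr (0 : Fin 3)) (Sum.inr (2 : Fin 3))
        (Or.inr ⟨(1 : Fin 3), (0 : Fin 3), (2 : Fin 3), ⟨rfl, rfl, rfl⟩, rfl, rfl, rfl⟩)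
      rw [this, h0, h1, show -2 * v - h = 2 * (-v - h) - (-h) by ring, hX]
    refine ⟨X, hX, ?_⟩
    rintro (a | a)
    · exact hfX a
    · change Fin 3 at a
      fin_cases a
      · exact h0
      · exact h1
      · exact h2

theorem exists_isUniversalColoring_row_neg (n : ℕ) :
    ∃ c, (row neg n).IsUniversalColoring 1 (-n) c := by
  induction n with
  | zero => exact exists_isUniversalColoring_zero
  | succ n ih =>
    have := exists_isUniversalColoring_hsum_neg ih
    push_cast
    rwa [neg_add']

theorem exists_isUniversalColoring_row_pos (n : ℕ) :
    ∃ c, (row pos n).IsUniversalColoring 1 n c := by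
  induction n with
  | zero => exact exists_isUniversalColoring_zero
  | succ n ih => exact_mod_cast exists_isUniversalColoring_hsum_pos ih

theorem exists_isUniversalColoring_twists (e : ℤ) :
    ∃ c, (twists e).IsUniversalColoring 1 (-e) c := by
  cases e with
  | ofNat n => exact exists_isUniversalColoring_row_neg n
  | negSucc n => exact exists_isUniversalColoring_row_pos (n + 1)

theorem exists_isUniversalColoring_rational (p q : ℕ) (hq : 0 < q) (hcop : Nat.Coprime p q) :
    ∃ c, (rational p q).IsUniversalColoring q p c := by
  induction hn : p + q using Nat.strong_induction_on generalizing p q with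
  | _ n ih =>
    subst hn
    rcases Nat.eq_zero_or_pos p with rfl | hp
    -- Coprimality makes the Euclidean algorithm stop at the fraction `0 / 1`, whose two arcs have
    -- colours at distance `1`.
    · obtain rfl : q = 1 := by simpa using hcop
      rw [rational, if_neg one_ne_zero, if_pos rfl]
      exact_mod_cast exists_isUniversalColoring_zero
    rcases lt_or_ge p q with h | hle
    · have := exists_isUniversalColoring_vsum_pos
        (ih (p + (q - p)) (by omega) p (q - p) (by omega)
          ((Nat.coprime_sub_self_right h.le).2 hcop) rfl)
      rw [rational, if_neg hq.ne', if_neg hp.ne', if_pos h]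
      rwa [Nat.cast_sub h.le, sub_add_cancel] at this
    · have := exists_isUniversalColoring_hsum_pos
        (ih (p - q + q) (by omega) (p - q) q hq ((Nat.coprime_sub_self_left hle).2 hcop) rfl)
      rw [rational, if_neg hq.ne', if_neg hp.ne', if_neg hle.not_gt]
      rwa [Nat.cast_sub hle, sub_add_cancel] at this

end TangleDiagram

/-! ## Pairs of dihedral quandles acting on each other -/

/-- `x` and `y` are geodesic sequences which act on each other as in the quandle of a
`(2, 2, p / q)`-Montesinos link. -/
structure IsDihedralPair {α : Type} (op : α → α → α) (q w : ℤ) (x y : ℤ → α) : Prop where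
  xx : IsGeodesicSeq op x
  yy : IsGeodesicSeq op y
  yx : ∀ j n m, op (y j) (x (w * n + q * m)) = x (w * n - q * m + (2 * j - 1) * q)
  xy : ∀ j n m, op (x (w * n + q * m)) (y j) = y (2 * m + 1 - j)

/-- The sequence that has the terms of `y` and those of `x` at distance `q` alternately. -/
def interleave {α : Type} (q s : ℤ) (x y : ℤ → α) (i : ℤ) : α :=
  if Even i then y (i / 2) else x (s + q * (i / 2))

theorem interleave_even {α : Type} (q s : ℤ) (x y : ℤ → α) (j : ℤ) :
    interleave q s x y (2 * j) = y j := by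
  simp only [interleave, even_two_mul, if_true]
  congr 1; omega

theorem interleave_odd {α : Type} (q s : ℤ) (x y : ℤ → α) (j : ℤ) :
    interleave q s x y (2 * j + 1) = x (s + q * j) := by
  have : ¬ Even (2 * j + 1) := by rw [Int.not_even_iff_odd]; exact ⟨j, rfl⟩
  simp only [interleave, this, if_false]
  congr 3; omega

namespace IsDihedralPair

variable {α : Type} {op : α → α → α} {q w : ℤ} {x y : ℤ → α}

/-- The cases `n = 0` and `n = -1` provide the colourings of the two tangles `1/2`. -/
theorem isGeodesicSeq_interleave (h : IsDihedralPair op q w x y) (n : ℤ) :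
    IsGeodesicSeq op (interleave q (w * n) x y) := by
  intro i j
  rcases Int.even_or_odd' i with ⟨i, rfl | rfl⟩ <;> rcases Int.even_or_odd' j with ⟨j, rfl | rfl⟩
  · rw [show 2 * (2 * j) - 2 * i = 2 * (2 * j - i) by ring]
    simp only [interleave_even, h.yy i j]
  · rw [show 2 * (2 * j + 1) - 2 * i = 2 * (2 * j + 1 - i) by ring]
    simp only [interleave_even, interleave_odd, h.xy]
  · rw [show 2 * (2 * j) - (2 * i + 1) = 2 * (2 * j - i - 1) + 1 by ring]
    simp only [interleave_even, interleave_odd, h.yx]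
    congr 1; ring
  · rw [show 2 * (2 * j + 1) - (2 * i + 1) = 2 * (2 * j - i) + 1 by ring]
    simp only [interleave_odd, ← h.xx _ _]
    congr 1; ring

/-- Replacing `(n, m)` by `(n + q, m - w)` does not change `w * n + q * m`, but shifts the result in
`xy` by `2 * w`. -/
theorem y_periodic (h : IsDihedralPair op q w x y) : Function.Periodic y (2 * w) := by
  intro j
  have h1 := h.xy (1 - j) 0 0
  have h2 := h.xy (1 - j) q (-w)
  rw [show w * q + q * -w = w * 0 + q * 0 by ring, h1] at h2
  have h3 := h.xy (1 - (j + 2 * w)) 0 0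
  have h4 := h.xy (1 - (j + 2 * w)) q (-w)
  rw [show w * q + q * -w = w * 0 + q * 0 by ring, h3] at h4
  convert h4 using 2 <;> ring

theorem x_periodic (h : IsDihedralPair op q w x y) (hqw : IsCoprime q w) :
    Function.Periodic x (2 * q * w) := by
  intro i
  obtain ⟨τ, σ, e⟩ := hqw
  -- Chosen so that `w * n - q * m = i + q`, whence `yx` with `j = 0` yields `x i`. The other
  -- representation of the same index shifts this by `2 * q * w`.
  have h1 := h.yx 0 (σ * (i + q)) (-τ * (i + q))
  have h2 := h.yx 0 (σ * (i + q) + q) (-τ * (i + q) - w)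
  rw [show w * (σ * (i + q) + q) + q * (-τ * (i + q) - w) =
    w * (σ * (i + q)) + q * (-τ * (i + q)) by ring, h1] at h2
  convert h2.symm using 2
  · linear_combination -(i + q) * e
  · linear_combination -(i + q) * e

/-- The sequences `z'` and `z` give the formulas for `n = -1` and `n = 0`. The other `n` follow
because `x (w * (n + 2) + q * m)` is the reflection of `x (w * n - q * m)` in `x (w * (n + 1))`, and
distributivity transports both actions through reflections. -/
theorem of_geodesicSeq (invol : ∀ a b, op b (op b a) = a)
    (distrib : ∀ a b c, op c (op b a) = op (op c b) (op c a)) {z z' : ℤ → α}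
    (hx : IsGeodesicSeq op x) (hz : IsGeodesicSeq op z) (hz' : IsGeodesicSeq op z')
    (hy : ∀ j, z (2 * j) = y j) (hy' : ∀ j, z' (2 * j) = y j)
    (hzx : ∀ j, z (2 * j + 1) = x (q * j)) (hzx' : ∀ j, z' (2 * j + 1) = x (q * j - w)) :
    IsDihedralPair op q w x y where
  xx := hx
  yy := by
    intro i j
    rw [← hy, ← hy, ← hy, show 2 * (2 * j - i) = 2 * (2 * j) - 2 * i by ring, hz]
  yx := by
    intro j n
    refine Int.two_step_induction (P := fun n => ∀ m,
      op (y j) (x (w * n + q * m)) = x (w * n - q * m + (2 * j - 1) * q)) (-1) ?_ ?_ ?_ ?_ n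
    · intro m
      have := hz' (2 * m + 1) (2 * j)
      rw [show 2 * (2 * j) - (2 * m + 1) = 2 * (2 * j - m - 1) + 1 by ring, hzx', hzx', hy'] at this
      rw [show w * -1 + q * m = q * m - w by ring, ← this]
      congr 1; ring
    · intro m
      have := hz (2 * m + 1) (2 * j)
      rw [show 2 * (2 * j) - (2 * m + 1) = 2 * (2 * j - m - 1) + 1 by ring, hzx, hzx, hy] at this
      rw [show w * (-1 + 1) + q * m = q * m by ring, ← this]
      congr 1; ring
    · intro n h0 h1 m
      rw [show w * (n + 2) + q * m = 2 * (w * (n + 1) + q * 0) - (w * n + q * (-m)) by ring, hx,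
        distrib, h1, h0, ← hx]
      congr 1; ring
    · intro n h0 h1 m
      rw [show w * (n - 1) + q * m = 2 * (w * n + q * 0) - (w * (n + 1) + q * (-m)) by ring, hx,
        distrib, h1, h0, ← hx]
      congr 1; ring
  xy := by
    have conj : ∀ a b c, op (op b a) c = op b (op a (op b c)) := by
      intro a b c
      rw [distrib, invol]
    intro j n m
    refine Int.two_step_induction (P := fun n => ∀ m j,
      op (x (w * n + q * m)) (y j) = y (2 * m + 1 - j)) (-1) ?_ ?_ ?_ ?_ n m j
    · intro m j
      have := hz' (2 * j) (2 * m + 1)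
      rw [show 2 * (2 * m + 1) - 2 * j = 2 * (2 * m + 1 - j) by ring, hzx', hy', hy'] at this
      rw [this]
      congr 2; ring
    · intro m j
      have := hz (2 * j) (2 * m + 1)
      rw [show 2 * (2 * m + 1) - 2 * j = 2 * (2 * m + 1 - j) by ring, hzx, hy, hy] at this
      rw [this]
      congr 2; ring
    · intro n h0 h1 m j
      rw [show w * (n + 2) + q * m = 2 * (w * (n + 1) + q * 0) - (w * n + q * (-m)) by ring, hx,
        conj, h1, h0, h1]
      congr 1; ring
    · intro n h0 h1 m j
      rw [show w * (n - 1) + q * m = 2 * (w * n + q * 0) - (w * (n + 1) + q * (-m)) by ring, hx,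
        conj, h0, h1, h0]
      congr 1; ring

end IsDihedralPair

/-! ## A model -/

namespace DihedralPair

/-- Equality of the elements `x i` (encoded by `inl i`) and `y j` (encoded by `inr j`). -/
def Rel (q w : ℤ) : ℤ ⊕ ℤ → ℤ ⊕ ℤ → Prop
  | Sum.inl i, Sum.inl i' => 2 * q * w ∣ i - i'
  | Sum.inr j, Sum.inr j' => 2 * w ∣ j - j'
  | _, _ => False

/-- The equality of elements of the model as a setoid. -/
def setoid (q w : ℤ) : Setoid (ℤ ⊕ ℤ) where
  r := Rel q w
  iseqv := by
    refine ⟨?_, ?_, ?_⟩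
    · rintro (i | i) <;> simp [Rel]
    · rintro (i | i) (j | j) <;> simp only [Rel, imp_self]
      · exact fun h => (dvd_sub_comm).1 h
      · exact fun h => (dvd_sub_comm).1 h
    · rintro (i | i) (j | j) (k | k) <;> simp only [Rel, imp_self, false_imp_iff, imp_true_iff]
      · exact fun h h' => by simpa using dvd_add h h'
      · exact fun h h' => by simpa using dvd_add h h'

/-- The operation on the model, where `τ * q + σ * w = 1`. -/
def preOp (q w τ σ : ℤ) : ℤ ⊕ ℤ → ℤ ⊕ ℤ → ℤ ⊕ ℤ
  | Sum.inl k, Sum.inl i => Sum.inl (2 * k - i)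
  | Sum.inr k, Sum.inr i => Sum.inr (2 * k - i)
  | Sum.inr j, Sum.inl i => Sum.inl (w * (σ * i) - q * (τ * i) + (2 * j - 1) * q)
  | Sum.inl i, Sum.inr j => Sum.inr (2 * (τ * i) + 1 - j)

theorem rel_preOp {q w τ σ : ℤ} {a a' b b' : ℤ ⊕ ℤ} (ha : Rel q w a a')
    (hb : Rel q w b b') : Rel q w (preOp q w τ σ a b) (preOp q w τ σ a' b') := by
  rcases a with a | a <;> rcases a' with a' | a' <;> rcases b with b | b <;>
    rcases b' with b' | b' <;> simp only [Rel] at ha hb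
  all_goals
    obtain ⟨s, hs⟩ := ha
    obtain ⟨t, ht⟩ := hb
    obtain rfl := eq_add_of_sub_eq hs
    obtain rfl := eq_add_of_sub_eq ht
  · exact ⟨2 * s - t, by ring⟩
  · exact ⟨2 * τ * q * s - t, by ring⟩
  · exact ⟨(w * σ - q * τ) * t + 2 * s, by ring⟩
  · exact ⟨2 * s - t, by ring⟩

/-- The model: a union of dihedral quandles of orders `2 q |w|` and `2 |w|`. -/
def Model (q w : ℤ) : Type := Quotient (setoid q w)

/-- `op b a` is the element `a ▷ b` of the model. -/
def op (q w τ σ : ℤ) (b a : Model q w) : Model q w :=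
  Quotient.map₂ (sa := setoid q w) (sb := setoid q w) (sc := setoid q w) (preOp q w τ σ)
    (fun _ _ h _ _ h' => rel_preOp h h') b a

/-- The elements of the long dihedral quandle. -/
def x (q w i : ℤ) : Model q w := Quotient.mk (setoid q w) (Sum.inl i)

/-- The elements of the short dihedral quandle. -/
def y (q w j : ℤ) : Model q w := Quotient.mk (setoid q w) (Sum.inr j)

variable {q w τ σ : ℤ}

theorem x_eq_x {i i' : ℤ} : x q w i = x q w i' ↔ 2 * q * w ∣ i - i' :=
  ⟨fun h => Quotient.exact (s := setoid q w) h, fun h => Quotient.sound (s := setoid q w) h⟩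

theorem y_eq_y {i i' : ℤ} : y q w i = y q w i' ↔ 2 * w ∣ i - i' :=
  ⟨fun h => Quotient.exact (s := setoid q w) h, fun h => Quotient.sound (s := setoid q w) h⟩

theorem x_ne_y {i j : ℤ} : x q w i ≠ y q w j :=
  fun h => (Quotient.exact (s := setoid q w) h : False)

theorem exists_rep (a : Model q w) : (∃ i, a = x q w i) ∨ ∃ j, a = y q w j := by
  induction a using Quotient.inductionOn with | _ a
  rcases a with i | j
  · exact Or.inl ⟨i, rfl⟩
  · exact Or.inr ⟨j, rfl⟩

theorem op_x_x (k i : ℤ) : op q w τ σ (x q w k) (x q w i) = x q w (2 * k - i) := rfl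

theorem op_y_y (k i : ℤ) : op q w τ σ (y q w k) (y q w i) = y q w (2 * k - i) := rfl

theorem op_y_x (j i : ℤ) : op q w τ σ (y q w j) (x q w i) =
    x q w (w * (σ * i) - q * (τ * i) + (2 * j - 1) * q) := rfl

theorem op_x_y (i j : ℤ) : op q w τ σ (x q w i) (y q w j) = y q w (2 * (τ * i) + 1 - j) := rfl

/-- The model evaluates at the representation `n = σ * i`, `m = τ * i`; any other representation
changes the result by a multiple of the period. -/
theorem isDihedralPair (e : τ * q + σ * w = 1) :
    IsDihedralPair (op q w τ σ) q w (x q w) (y q w) where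
  xx i j := rfl
  yy i j := rfl
  yx j n m := by
    rw [op_y_x, x_eq_x]
    refine ⟨σ * m - τ * n, ?_⟩
    linear_combination (w * n - q * m) * e
  xy j n m := by
    rw [op_x_y, y_eq_y]
    refine ⟨τ * n - σ * m, ?_⟩
    linear_combination (2 * m) * e

theorem exists_rep_of_coprime (e : τ * q + σ * w = 1) (a : Model q w) :
    (∃ n m, a = x q w (w * n + q * m)) ∨ ∃ j, a = y q w j := by
  obtain ⟨i, rfl⟩ | h := exists_rep a
  · refine Or.inl ⟨σ * i, τ * i, congrArg _ ?_⟩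
    linear_combination -i * e
  · exact Or.inr h

/-- On indices `w * n + q * m` the operations act on `n` and `m` separately, which reduces the
quandle axioms to ring identities. -/
theorem op_x_x' (n m n' m' : ℤ) :
    op q w τ σ (x q w (w * n + q * m)) (x q w (w * n' + q * m')) =
      x q w (w * (2 * n - n') + q * (2 * m - m')) := by
  rw [op_x_x]; congr 1; ring

theorem op_y_x' (e : τ * q + σ * w = 1) (j n m : ℤ) :
    op q w τ σ (y q w j) (x q w (w * n + q * m)) = x q w (w * n + q * (2 * j - 1 - m)) := by
  rw [(isDihedralPair e).yx]; congr 1; ring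

theorem op_idem (a : Model q w) : op q w τ σ a a = a := by
  obtain ⟨i, rfl⟩ | ⟨i, rfl⟩ := exists_rep a
  · rw [op_x_x]; congr 1; ring
  · rw [op_y_y]; congr 1; ring

theorem op_invol (e : τ * q + σ * w = 1) (a b : Model q w) :
    op q w τ σ b (op q w τ σ b a) = a := by
  obtain ⟨n, m, rfl⟩ | ⟨i, rfl⟩ := exists_rep_of_coprime e a <;>
    obtain ⟨n', m', rfl⟩ | ⟨j, rfl⟩ := exists_rep_of_coprime e b <;>
    simp only [op_x_x', (isDihedralPair e).xy, op_y_x' e, op_y_y] <;> congr 1 <;> ring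

theorem op_distrib (e : τ * q + σ * w = 1) (a b c : Model q w) :
    op q w τ σ c (op q w τ σ b a) = op q w τ σ (op q w τ σ c b) (op q w τ σ c a) := by
  obtain ⟨n, m, rfl⟩ | ⟨i, rfl⟩ := exists_rep_of_coprime e a <;>
    obtain ⟨n', m', rfl⟩ | ⟨j, rfl⟩ := exists_rep_of_coprime e b <;>
    obtain ⟨n'', m'', rfl⟩ | ⟨k, rfl⟩ := exists_rep_of_coprime e c <;>
    simp only [op_x_x', (isDihedralPair e).xy, op_y_x' e, op_y_y] <;> congr 1 <;> ring

end DihedralPair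

/-! ## The quandle of the link in coordinates -/

/-- The value of a formal product under an assignment of the generators. -/
def FreeMagma.evalOp {X α : Type} (op : α → α → α) (g : X → α) : FreeMagma X → α
  | FreeMagma.of e => g e
  | FreeMagma.mul a b => op (evalOp op g b) (evalOp op g a)

/-- The universal property of a presented involutory quandle. -/
theorem PresentedInvQuandle.exists_lift {X α : Type} {r : FreeMagma X → FreeMagma X → Prop}
    {op : α → α → α} (idem : ∀ a, op a a = a) (invol : ∀ a b, op b (op b a) = a)
    (distrib : ∀ a b c, op c (op b a) = op (op c b) (op c a)) (g : X → α)
    (hr : ∀ a b, r a b → FreeMagma.evalOp op g a = FreeMagma.evalOp op g b) :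
    ∃ φ : PresentedInvQuandle r → α, (∀ e, φ (of r e) = g e) ∧
      ∀ a b, φ (b ◃ a) = op (φ b) (φ a) := by
  have key : ∀ a b, InvQuandleCon r a b → FreeMagma.evalOp op g a = FreeMagma.evalOp op g b := by
    intro a b h
    induction h with
    | rel h => exact hr _ _ h
    | refl => rfl
    | symm _ ih => exact ih.symm
    | trans _ _ ih ih' => exact ih.trans ih'
    | mul _ _ ih ih' => exact congrArg₂ op ih' ih
    | idem a => exact idem _
    | invol a b => exact invol _ _
    | distrib a b c => exact distrib _ _ _
  refine ⟨Quotient.lift (s := invQuandleSetoid r) (FreeMagma.evalOp op g) key, fun e => rfl, ?_⟩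
  intro a b
  induction a using Quotient.inductionOn with | _ a
  induction b using Quotient.inductionOn with | _ b
  rfl

theorem PresentedInvQuandle.induction_of {X : Type} {r : FreeMagma X → FreeMagma X → Prop}
    {P : PresentedInvQuandle r → Prop} (hof : ∀ e, P (of r e))
    (hact : ∀ a b, P a → P b → P (b ◃ a)) (a : PresentedInvQuandle r) : P a := by
  induction a using Quotient.inductionOn with | _ a
  induction a with
  | ih1 e => exact hof e
  | ih2 a b iha ihb => exact hact _ _ iha ihb

/-- The sequences `x` and `y` parametrize `Q` by the integers modulo `2 q w` and `2 w`. -/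
structure IsParametrization {Q : Type} [Quandle Q] (q w : ℤ) (x y : ℤ → Q) : Prop extends
    IsDihedralPair (fun b a => b ◃ a) q w x y where
  invAct_eq : ∀ a b : Q, b ◃⁻¹ a = b ◃ a
  surj : ∀ a, (∃ i, a = x i) ∨ ∃ j, a = y j
  x_eq_x : ∀ i i', x i = x i' ↔ 2 * q * w ∣ i - i'
  y_eq_y : ∀ j j', y j = y j' ↔ 2 * w ∣ j - j'
  x_ne_y : ∀ i j, x i ≠ y j

/-! ### Gluing the colourings of the four tangles. -/

namespace TangleDiagram

theorem isColoring_of (T : TangleDiagram) :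
    T.IsColoring (fun b a : T.ClosureQuandle => b ◃ a) (PresentedInvQuandle.of T.WirtingerRel) :=
  ⟨fun _ _ _ h => (Quotient.sound (InvQuandleCon.rel (WirtingerRel.crossing h))).symm,
    fun _ _ h => Quotient.sound (InvQuandleCon.rel (WirtingerRel.joined h))⟩

theorem IsColoring.comp {α β : Type} {op : α → α → α} {op' : β → β → β} {T : TangleDiagram}
    {c : T.Edge → α} (hc : T.IsColoring op c) {φ : α → β}
    (hφ : ∀ a b, φ (op b a) = op' (φ b) (φ a)) : T.IsColoring op' fun e => φ (c e) :=
  ⟨fun u o v h => by simp only [hc.1 u o v h, hφ], fun a b h => congrArg φ (hc.2 a b h)⟩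

/-- Colourings that agree on the closing arcs extend to the quandle of the closure. -/
theorem exists_closureQuandle_hom {α : Type} {op : α → α → α} (idem : ∀ a, op a a = a)
    (invol : ∀ a b, op b (op b a) = a)
    (distrib : ∀ a b c, op c (op b a) = op (op c b) (op c a)) {T : TangleDiagram} {g : T.Edge → α}
    (hg : T.IsColoring op g) (htop : g T.nw = g T.ne) (hbot : g T.sw = g T.se) :
    ∃ φ : T.ClosureQuandle → α, (∀ e, φ (PresentedInvQuandle.of T.WirtingerRel e) = g e) ∧
      ∀ a b, φ (b ◃ a) = op (φ b) (φ a) := by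
  refine PresentedInvQuandle.exists_lift idem invol distrib g ?_
  rintro a b (h | h | _ | _)
  · exact (hg.1 _ _ _ h).symm
  · exact hg.2 _ _ h
  · exact htop
  · exact hbot

section Montesinos

variable {tw A B C : TangleDiagram} {p q e w : ℤ} {ctw : tw.Edge → ℤ} {cA : A.Edge → ℤ}
  {cB : B.Edge → ℤ} {cC : C.Edge → ℤ}

open DihedralPair in
theorem exists_hom_model (htw : tw.IsUniversalColoring 1 (-e) ctw)
    (hA : A.IsUniversalColoring 2 1 cA) (hB : B.IsUniversalColoring 2 1 cB)
    (hC : C.IsUniversalColoring q p cC) (hw : w = (e - 1) * q - p) {τ σ : ℤ}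
    (hτσ : τ * q + σ * w = 1) :
    ∃ φ : (((tw.hsum A).hsum B).hsum C).ClosureQuandle → Model q w,
      (∀ a b, φ (b ◃ a) = op q w τ σ (φ b) (φ a)) ∧
      (∀ a, φ (PresentedInvQuandle.of _ (Sum.inl (Sum.inl (Sum.inr a)))) =
        interleave q 0 (x q w) (y q w) (cA a + 3)) ∧
      ∀ a, φ (PresentedInvQuandle.of _ (Sum.inr a)) = x q w (cC a - w) := by
  have hM := isDihedralPair (q := q) (w := w) hτσ
  have dih : ∀ {Y : ℤ → Model q w}, IsGeodesicSeq (op q w τ σ) Y →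
      ∀ a b : ℤ, Y ((fun j i => 2 * j - i) b a) = op q w τ σ (Y b) (Y a) := fun h a b => h a b
  set z : ℤ → Model q w := interleave q 0 (x q w) (y q w) with hz
  set z' : ℤ → Model q w := interleave q (-w) (x q w) (y q w) with hz'
  have gz : IsGeodesicSeq (op q w τ σ) z := by
    simpa using hM.isGeodesicSeq_interleave 0
  have gz' : IsGeodesicSeq (op q w τ σ) z' := by
    simpa using hM.isGeodesicSeq_interleave (-1)
  have z_even : ∀ j, z (2 * j) = y q w j := interleave_even _ _ _ _
  have z_odd : ∀ j, z (2 * j + 1) = x q w (0 + q * j) := interleave_odd _ _ _ _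
  have z'_even : ∀ j, z' (2 * j) = y q w j := interleave_even _ _ _ _
  have z'_odd : ∀ j, z' (2 * j + 1) = x q w (-w + q * j) := interleave_odd _ _ _ _
  -- The offsets put the SE corner of the first tangle `1/2` at `y 0` and make the colours agree
  -- wherever tangles meet. With them, the closing arcs agree exactly because `w = (e - 1) * q - p`.
  have ktw := htw.isColoring.comp (dih (hM.xx.affine q ((1 - e) * q)))
  have kA := hA.isColoring.comp (dih (gz.affine 1 3))
  have kB := hB.isColoring.comp (dih (gz'.affine 1 2))
  have kC := hC.isColoring.comp (dih (hM.xx.affine 1 (-w)))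
  have h1 := ktw.hsum kA
    (by
      rw [htw.ne, hA.nw]
      refine Eq.trans ?_ (z_odd 1).symm
      congr 1; ring)
    (by
      rw [htw.se, hA.sw]
      refine Eq.trans ?_ (z_odd 0).symm
      congr 1; ring)
  have h2 := h1.hsum kB
    (by
      change z (1 * cA A.ne + 3) = z' (1 * cB B.nw + 2)
      rw [hA.ne, hB.nw]
      exact (z_even 1).trans (z'_even 1).symm)
    (by
      change z (1 * cA A.se + 3) = z' (1 * cB B.sw + 2)
      rw [hA.se, hB.sw]
      exact (z_even 0).trans (z'_even 0).symm)
  have h3 := h2.hsum kC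
    (by
      change z' (1 * cB B.ne + 2) = x q w (1 * cC C.nw + -w)
      rw [hB.ne, hC.nw]
      refine (z'_odd 0).trans ?_
      congr 1; ring)
    (by
      change z' (1 * cB B.se + 2) = x q w (1 * cC C.sw + -w)
      rw [hB.se, hC.sw]
      refine (z'_odd (-1)).trans ?_
      congr 1; ring)
  obtain ⟨φ, hφ, hom⟩ := exists_closureQuandle_hom op_idem (op_invol hτσ) (op_distrib hτσ) h3
    (by
      change x q w (q * ctw tw.nw + (1 - e) * q) = x q w (1 * cC C.ne + -w)
      rw [htw.nw, hC.ne, hw]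
      congr 1; ring)
    (by
      change x q w (q * ctw tw.sw + (1 - e) * q) = x q w (1 * cC C.se + -w)
      rw [htw.sw, hC.se, hw]
      congr 1; ring)
  refine ⟨φ, hom, fun a => (hφ _).trans ?_, fun a => (hφ _).trans ?_⟩
  · change z (1 * cA a + 3) = _
    rw [one_mul]
  · change x q w (1 * cC a + -w) = _
    rw [one_mul, sub_eq_add_neg]

/-- Factoring the tautological colouring through the universal ones shows that `x` and `y` exhaust
the quandle; the homomorphism `φ` to the model separates their terms. -/
theorem exists_parametrization (htw : tw.IsUniversalColoring 1 (-e) ctw)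
    (hA : A.IsUniversalColoring 2 1 cA) (hB : B.IsUniversalColoring 2 1 cB)
    (hC : C.IsUniversalColoring q p cC) (hw : w = (e - 1) * q - p) (hqw : IsCoprime q w) :
    ∃ x y : ℤ → (((tw.hsum A).hsum B).hsum C).ClosureQuandle, IsParametrization q w x y ∧
      PresentedInvQuandle.of _ (Sum.inl (Sum.inl (Sum.inr A.sw))) = x 0 ∧
      PresentedInvQuandle.of _ (Sum.inl (Sum.inl (Sum.inr A.se))) = y 0 ∧
      PresentedInvQuandle.of _ (Sum.inl (Sum.inr B.ne)) = x (-w) := by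
  obtain ⟨τ, σ, hτσ⟩ := id hqw
  set T := ((tw.hsum A).hsum B).hsum C with hT
  obtain ⟨φ, hom, φA, φC⟩ : ∃ φ : T.ClosureQuandle → DihedralPair.Model q w, _ :=
    exists_hom_model htw hA hB hC hw hτσ
  have invol : ∀ a b : T.ClosureQuandle, b ◃ b ◃ a = a :=
    fun a b => PresentedInvQuandle.act_act b a
  have distrib : ∀ a b c : T.ClosureQuandle, c ◃ b ◃ a = (c ◃ b) ◃ c ◃ a :=
    fun a b c => Shelf.self_distrib
  set g : T.Edge → T.ClosureQuandle := PresentedInvQuandle.of T.WirtingerRel with hg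
  have kT := isColoring_of T
  have k1 := kT.hsum_left
  have k2 := k1.hsum_left
  obtain ⟨V, gV, fV⟩ := htw.factor _ invol _ k2.hsum_left
  obtain ⟨Z₀, gZ₀, fZ₀⟩ := hA.factor _ invol _ k2.hsum_right
  obtain ⟨Z₁, gZ₁, fZ₁⟩ := hB.factor _ invol _ k1.hsum_right
  obtain ⟨X₀, gX₀, fX₀⟩ := hC.factor _ invol _ kT.hsum_right
  -- the four tangles are joined
  have j1 : V e = Z₀ 0 := by
    have := k2.hsum_top
    rwa [fV, fZ₀, htw.ne, hA.nw, neg_neg] at this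
  have j2 : V (e - 1) = Z₀ (-2) := by
    have := k2.hsum_bottom
    rwa [fV, fZ₀, htw.se, hA.sw, neg_neg] at this
  have j3 : Z₀ (-1) = Z₁ 0 := by
    have : g _ = g _ := k1.hsum_top
    rw [← hB.nw, ← hA.ne, ← fZ₀, ← fZ₁]
    exact this
  have j4 : Z₀ (-3) = Z₁ (-2) := by
    have : g _ = g _ := k1.hsum_bottom
    rw [← hB.sw, show (-3 : ℤ) = -1 - 2 by norm_num, ← hA.se, ← fZ₀, ← fZ₁]
    exact this
  have j5 : Z₁ (-1) = X₀ 0 := by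
    have : g _ = g _ := kT.hsum_top
    rw [← hC.nw, ← hB.ne, ← fZ₁, ← fX₀]
    exact this
  have j6 : Z₁ (-3) = X₀ (-q) := by
    have : g _ = g _ := kT.hsum_bottom
    rw [← hC.sw, show (-3 : ℤ) = -1 - 2 by norm_num, ← hB.se, ← fZ₁, ← fX₀]
    exact this
  have j7 : V 0 = X₀ (-p) := by
    have : g T.nw = g T.ne :=
      Quotient.sound (s := invQuandleSetoid T.WirtingerRel) (InvQuandleCon.rel WirtingerRel.top)
    rw [← htw.nw, ← hC.ne, ← fV, ← fX₀]
    exact this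
  have j8 : V (-1) = X₀ (-p - q) := by
    have : g T.sw = g T.se :=
      Quotient.sound (s := invQuandleSetoid T.WirtingerRel) (InvQuandleCon.rel WirtingerRel.bottom)
    rw [← htw.sw, ← hC.se, ← fV, ← fX₀]
    exact this
  have fA : ∀ a, g (Sum.inl (Sum.inl (Sum.inr a))) = Z₀ (cA a) := fZ₀
  have fB : ∀ a, g (Sum.inl (Sum.inr a)) = Z₁ (cB a) := fZ₁
  -- normalized sequences
  set x : ℤ → T.ClosureQuandle := fun i => X₀ (1 * i + w) with hx
  set z : ℤ → T.ClosureQuandle := fun i => Z₀ (1 * i + -3) with hz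
  set z' : ℤ → T.ClosureQuandle := fun i => Z₁ (1 * i + -2) with hz'
  have gx : IsGeodesicSeq (fun b a => b ◃ a) x := gX₀.affine 1 w
  have gz : IsGeodesicSeq (fun b a => b ◃ a) z := gZ₀.affine 1 (-3)
  have gz' : IsGeodesicSeq (fun b a => b ◃ a) z' := gZ₁.affine 1 (-2)
  -- The two closing arcs are the terms `-1` and `0` of `V`, so they determine it.
  have Vx : ∀ i, V i = x (q * i + (1 - e) * q) := by
    refine gV.unique (gx.affine q ((1 - e) * q)) (-1) ?_ ?_
    · refine j8.trans (congrArg X₀ ?_)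
      rw [hw]; ring
    · refine j7.trans (congrArg X₀ ?_)
      rw [hw]; ring
  have zx : ∀ j, z (2 * j + 1) = x (q * j) := by
    intro j
    have := (gz.affine 2 1).unique (gx.affine q 0) 0 (by
      refine j2.symm.trans ((Vx _).trans (congrArg x ?_))
      ring) (by
      refine j1.symm.trans ((Vx _).trans (congrArg x ?_))
      ring) j
    simpa using this
  have zx' : ∀ j, z' (2 * j + 1) = x (q * j - w) := by
    intro j
    have := (gz'.affine 2 1).unique (gx.affine q (-w)) (-1) (by
      refine j6.trans (congrArg X₀ ?_)
      ring) (by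
      refine j5.trans (congrArg X₀ ?_)
      ring) j
    simpa [sub_eq_add_neg] using this
  have zz' : ∀ j, z' (2 * j) = z (2 * j) := by
    intro j
    have := (gz'.affine 2 0).unique (gz.affine 2 0) 0 j4.symm j3.symm j
    simpa using this
  have hpair : IsDihedralPair (fun b a : T.ClosureQuandle => b ◃ a) q w x fun j => z (2 * j) :=
    IsDihedralPair.of_geodesicSeq invol distrib gx gz gz' (fun _ => rfl) zz' zx zx'
  have φx : ∀ i, φ (x i) = DihedralPair.x q w i := by
    -- `φ` is known only on arcs, but two arcs have neighbouring colours, and this determines `φ` on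
    -- the whole sequence.
    obtain ⟨a, b, hab⟩ := hC.adjacent
    have key : ∀ a, φ (x (cC a - w)) = DihedralPair.x q w (cC a - w) := by
      intro a
      rw [← φC]
      refine congrArg φ ((congrArg X₀ ?_).trans (fX₀ a).symm)
      ring
    refine (gx.comp hom).unique (DihedralPair.isDihedralPair hτσ).xx (cC a - w) (key a) ?_
    rw [show cC a - w + 1 = cC b - w by rw [hab]; ring]
    exact key b
  have φz : ∀ i, φ (z i) = interleave q 0 (DihedralPair.x q w) (DihedralPair.y q w) i := by
    obtain ⟨a, b, hab⟩ := hA.adjacent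
    have key : ∀ a, φ (z (cA a + 3)) =
        interleave q 0 (DihedralPair.x q w) (DihedralPair.y q w) (cA a + 3) := by
      intro a
      rw [← φA]
      refine congrArg φ ((congrArg Z₀ ?_).trans (fA a).symm)
      ring
    have gi := (DihedralPair.isDihedralPair hτσ).isGeodesicSeq_interleave 0
    rw [mul_zero] at gi
    refine (gz.comp hom).unique gi (cA a + 3) (key a) ?_
    rw [show cA a + 3 + 1 = cA b + 3 by rw [hab]; ring]
    exact key b
  have φy : ∀ j, φ (z (2 * j)) = DihedralPair.y q w j := fun j =>
    (φz _).trans (interleave_even _ _ _ _ _)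
  have hz_mem : ∀ i, (∃ k, z i = x k) ∨ ∃ j, z i = z (2 * j) := by
    intro i
    rcases Int.even_or_odd' i with ⟨j, rfl | rfl⟩
    · exact Or.inr ⟨j, rfl⟩
    · exact Or.inl ⟨_, zx j⟩
  have hz'_mem : ∀ i, (∃ k, z' i = x k) ∨ ∃ j, z' i = z (2 * j) := by
    intro i
    rcases Int.even_or_odd' i with ⟨j, rfl | rfl⟩
    · exact Or.inr ⟨j, zz' j⟩
    · exact Or.inl ⟨_, zx' j⟩
  refine ⟨x, fun j => z (2 * j), ⟨hpair, fun _ _ => rfl, ?_, ?_, ?_, ?_⟩, ?_, ?_, ?_⟩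
  · refine PresentedInvQuandle.induction_of ?_ ?_
    · rintro (((a | a) | a) | a)
      · exact Or.inl ⟨_, (fV a).trans (Vx _)⟩
      · rw [show PresentedInvQuandle.of T.WirtingerRel (Sum.inl (Sum.inl (Sum.inr a))) =
          z (cA a + 3) from (fA a).trans (congrArg Z₀ (by ring))]
        exact hz_mem _
      · rw [show PresentedInvQuandle.of T.WirtingerRel (Sum.inl (Sum.inr a)) =
          z' (cB a + 2) from (fB a).trans (congrArg Z₁ (by ring))]
        exact hz'_mem _
      · exact Or.inl ⟨cC a - w, (fX₀ a).trans (congrArg X₀ (by ring))⟩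
    · have rep : ∀ i, ∃ n m, i = w * n + q * m := fun i =>
        ⟨σ * i, τ * i, by linear_combination -i * hτσ⟩
      rintro _ _ (⟨i, rfl⟩ | ⟨i, rfl⟩) (⟨j, rfl⟩ | ⟨j, rfl⟩)
      · exact Or.inl ⟨_, (hpair.xx _ _).symm⟩
      · obtain ⟨n, m, rfl⟩ := rep i
        exact Or.inl ⟨_, hpair.yx _ _ _⟩
      · obtain ⟨n, m, rfl⟩ := rep j
        exact Or.inr ⟨_, hpair.xy _ _ _⟩
      · exact Or.inr ⟨_, (hpair.yy _ _).symm⟩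
  · refine fun i i' => ⟨fun h => ?_, fun ⟨k, hk⟩ => ?_⟩
    · rw [← DihedralPair.x_eq_x, ← φx, ← φx, h]
    · rw [eq_add_of_sub_eq hk, add_comm, mul_comm (2 * q * w)]
      exact (hpair.x_periodic hqw).int_mul k i'
  · refine fun i i' => ⟨fun h => ?_, fun ⟨k, hk⟩ => ?_⟩
    · rw [← DihedralPair.y_eq_y, ← φy, ← φy, h]
    · rw [eq_add_of_sub_eq hk, add_comm, mul_comm (2 * w)]
      exact hpair.y_periodic.int_mul k i'
  · intro i j h
    have := congrArg φ h
    rw [φx, φy] at this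
    exact DihedralPair.x_ne_y this
  · refine (fA _).trans ?_
    rw [hA.sw]
    refine (zx 0).trans ?_
    rw [mul_zero]
  · refine (fA _).trans ?_
    rw [hA.se]
    rfl
  · refine (fB _).trans ?_
    rw [hB.ne]
    refine (zx' 0).trans ?_
    rw [mul_zero, zero_sub]

end Montesinos

end TangleDiagram

/-! ## Subquandles, geodesics and components -/

section Geodesic

variable {Q : Type} [Quandle Q]

theorem geodesic_subset {S : Set Q} (hS : IsSubquandle S) {a b : Q} (ha : a ∈ S) (hb : b ∈ S) :
    geodesic a b ⊆ S :=
  Set.sInter_subset_of_mem ⟨hS, ha, hb⟩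

theorem left_mem_geodesic (a b : Q) : a ∈ geodesic a b := fun _ h => h.2.1

theorem right_mem_geodesic (a b : Q) : b ∈ geodesic a b := fun _ h => h.2.2

theorem act_mem_geodesic {a b c d : Q} (hc : c ∈ geodesic a b) (hd : d ∈ geodesic a b) :
    d ◃ c ∈ geodesic a b :=
  fun S h => (h.1 c (hc S h) d (hd S h)).1

/-- A maximal geodesic lies in some member of the covering family, hence equals it; a member cannot
be enlarged, since it would then lie in another member. -/
theorem isMaximalGeodesic_iff_of_cover {ι : Type} {F : ι → Set Q}
    (hF : ∀ i, ∃ a b, F i = geodesic a b) (hcover : ∀ a b, ∃ i, geodesic a b ⊆ F i)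
    (hanti : ∀ i j, F i ⊆ F j → i = j) (G : Set Q) :
    IsMaximalGeodesic G ↔ ∃ i, F i = G := by
  constructor
  · rintro ⟨⟨a, b, rfl⟩, hmax⟩
    obtain ⟨i, hi⟩ := hcover a b
    obtain ⟨c, d, hcd⟩ := hF i
    refine ⟨i, ?_⟩
    by_contra hne
    exact hmax c d (hcd ▸ hi.ssubset_of_ne (Ne.symm hne))
  · rintro ⟨i, rfl⟩
    refine ⟨hF i, fun a b hab => ?_⟩
    obtain ⟨j, hj⟩ := hcover a b
    obtain rfl := hanti i j (hab.subset.trans hj)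
    exact hab.not_subset hj

theorem mem_cayleyComponent {gens : Set Q} {a b : Q} :
    b ∈ cayleyComponent gens a ↔ (cayleyGraph gens).Reachable b a := by
  rw [cayleyComponent, SimpleGraph.ConnectedComponent.mem_supp_iff, SimpleGraph.ConnectedComponent.eq]

theorem reachable_act {gens : Set Q} {g : Q} (hg : g ∈ gens) (a : Q) :
    (cayleyGraph gens).Reachable a (g ◃ a) := by
  by_cases h : a = g ◃ a
  · rw [← h]
  · exact SimpleGraph.Adj.reachable ⟨h, Or.inl ⟨g, hg, rfl⟩⟩

theorem cayleyComponent_subset {gens : Set Q} (hinv : ∀ a b : Q, b ◃ b ◃ a = a) {S : Set Q}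
    (hS : ∀ a ∈ S, ∀ g ∈ gens, g ◃ a ∈ S) {a : Q} (ha : a ∈ S) :
    cayleyComponent gens a ⊆ S := by
  intro b hb
  rw [mem_cayleyComponent] at hb
  obtain ⟨p⟩ := hb
  induction p with
  | nil => exact ha
  | cons hadj _ ih =>
    obtain ⟨-, ⟨g, hg, h⟩ | ⟨g, hg, h⟩⟩ := hadj
    · have := hS _ (ih ha) g hg
      rwa [h, hinv] at this
    · rw [h]; exact hS _ (ih ha) g hg

end Geodesic

theorem Set.ncard_range_of_eq_iff_dvd {α : Type} {f : ℤ → α} {N : ℤ} (hN : N ≠ 0)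
    (hf : ∀ i j, f i = f j ↔ N ∣ i - j) :
    (Set.range f).Finite ∧ (Set.range f).ncard = N.natAbs := by
  have himg : Set.range f = f '' Set.Ico 0 |N| := by
    ext a
    constructor
    · rintro ⟨i, rfl⟩
      refine ⟨i % N, ⟨Int.emod_nonneg _ hN, Int.emod_lt_abs _ hN⟩, ?_⟩
      rw [hf, dvd_sub_comm]
      exact Int.dvd_self_sub_emod
    · rintro ⟨i, -, rfl⟩
      exact ⟨i, rfl⟩
  have hinj : Set.InjOn f (Set.Ico 0 |N|) := by
    intro i hi j hj hij
    rw [hf, ← abs_dvd] at hij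
    have := Int.eq_zero_of_abs_lt_dvd hij (abs_lt.2 ⟨by linarith [hi.1, hj.2], by
      linarith [hj.1, hi.2]⟩)
    linarith
  refine ⟨himg ▸ (Set.finite_Ico _ _).image f, ?_⟩
  rw [himg, hinj.ncard_image, Set.ncard_eq_toFinset_card']
  simp only [Set.toFinset_Ico, Int.card_Ico, sub_zero, Int.abs_eq_natAbs,
    Int.toNat_natCast]

/-- Two letters compose two reflections to a translation by `2 * (c - b)`; an odd number of letters
leaves a reflection. -/
theorem wordAct_altWord {Q : Type} [Quandle Q] {x : ℤ → Q}
    (hx : IsGeodesicSeq (fun b a => b ◃ a) x) (k : ℕ) (s b c : ℤ) :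
    wordAct (x s) (altWord (x b) (x c) k) =
      x (if Even k then s + k * (c - b) else 2 * b - s - (k - 1) * (c - b)) := by
  induction k generalizing s b c with
  | zero => simp [altWord, wordAct]
  | succ k ih =>
    have : wordAct (x s) (altWord (x b) (x c) (k + 1)) =
        wordAct (x (2 * b - s)) (altWord (x c) (x b) k) := by
      rw [hx]; rfl
    rw [this, ih]
    congr 1
    by_cases h : Even k
    · rw [if_pos h, if_neg (by simpa [Nat.even_add_one] using h)]
      push_cast; ring
    · rw [if_neg h, if_pos (by simpa [Nat.even_add_one] using h)]
      push_cast; ring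

/-! ## The geodesics in coordinates -/

namespace IsParametrization

variable {Q : Type} {q w : ℤ} {x y : ℤ → Q}

/-- The union of the short dihedral quandle and one class modulo `q` of the long one. -/
def shortSet (q : ℤ) (x y : ℤ → Q) (c : ℤ) : Set Q :=
  Set.range y ∪ Set.range fun k => x (c + q * k)

theorem y_mem_shortSet (c j : ℤ) : y j ∈ shortSet q x y c := Or.inl ⟨j, rfl⟩

theorem x_mem_shortSet_of_dvd {c i : ℤ} (h : q ∣ i - c) : x i ∈ shortSet q x y c := by
  obtain ⟨k, hk⟩ := h
  exact Or.inr ⟨k, congrArg x (by linarith)⟩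

theorem shortSet_congr {c c' : ℤ} (hc : q ∣ c - c') :
    shortSet q x y c = shortSet q x y c' := by
  have key : ∀ {c c' : ℤ}, q ∣ c - c' → shortSet q x y c ⊆ shortSet q x y c' := by
    rintro c c' hc _ (⟨j, rfl⟩ | ⟨k, rfl⟩)
    · exact y_mem_shortSet _ _
    · refine x_mem_shortSet_of_dvd ?_
      rw [show c + q * k - c' = c - c' + q * k by ring]
      exact dvd_add hc (dvd_mul_right q k)
  exact (key hc).antisymm (key ((dvd_sub_comm).1 hc))

variable [Quandle Q]

theorem isSubquandle_iff (h : IsParametrization q w x y) {S : Set Q} :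
    IsSubquandle S ↔ ∀ a ∈ S, ∀ b ∈ S, b ◃ a ∈ S := by
  simp only [IsSubquandle, h.invAct_eq, and_self]

theorem act_act (h : IsParametrization q w x y) (a b : Q) : b ◃ b ◃ a = a := by
  rw [← h.invAct_eq, Rack.invAct_act_eq]

theorem exists_rep (hqw : IsCoprime q w) (i : ℤ) : ∃ n m, i = w * n + q * m := by
  obtain ⟨τ, σ, e⟩ := hqw
  exact ⟨σ * i, τ * i, by linear_combination -i * e⟩

theorem act_x_x (h : IsParametrization q w x y) (k i : ℤ) : x k ◃ x i = x (2 * k - i) :=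
  (h.xx i k).symm

theorem act_y_y (h : IsParametrization q w x y) (k i : ℤ) : y k ◃ y i = y (2 * k - i) :=
  (h.yy i k).symm

theorem exists_act_y_x (h : IsParametrization q w x y) (hqw : IsCoprime q w) (j i : ℤ) :
    ∃ k, y j ◃ x i = x (i + q * k) := by
  obtain ⟨n, m, rfl⟩ := exists_rep hqw i
  refine ⟨-2 * m + (2 * j - 1), (h.yx j n m).trans (congrArg x ?_)⟩
  ring

theorem exists_act_x_y (h : IsParametrization q w x y) (hqw : IsCoprime q w) (j i : ℤ) :
    ∃ k, x i ◃ y j = y k := by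
  obtain ⟨n, m, rfl⟩ := exists_rep hqw i
  exact ⟨_, h.xy j n m⟩

theorem isSubquandle_range_x (h : IsParametrization q w x y) : IsSubquandle (Set.range x) := by
  rw [h.isSubquandle_iff]
  rintro _ ⟨i, rfl⟩ _ ⟨k, rfl⟩
  exact ⟨_, (h.act_x_x k i).symm⟩

theorem isSubquandle_shortSet (h : IsParametrization q w x y) (hqw : IsCoprime q w) (c : ℤ) :
    IsSubquandle (shortSet q x y c) := by
  rw [h.isSubquandle_iff]
  rintro _ (⟨i, rfl⟩ | ⟨i, rfl⟩) _ (⟨k, rfl⟩ | ⟨k, rfl⟩)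
  · rw [h.act_y_y]; exact y_mem_shortSet _ _
  · obtain ⟨l, hl⟩ := h.exists_act_x_y hqw i (c + q * k)
    simp only [hl]; exact y_mem_shortSet _ _
  · obtain ⟨l, hl⟩ := h.exists_act_y_x hqw k (c + q * i)
    simp only [hl]
    exact x_mem_shortSet_of_dvd ⟨i + l, by ring⟩
  · simp only [h.act_x_x]
    exact x_mem_shortSet_of_dvd ⟨2 * k - i, by ring⟩

theorem x_mem_shortSet (h : IsParametrization q w x y) {c i : ℤ} :
    x i ∈ shortSet q x y c ↔ q ∣ i - c := by
  refine ⟨?_, x_mem_shortSet_of_dvd⟩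
  rintro (⟨j, hj⟩ | ⟨k, hk⟩)
  · exact absurd hj.symm (h.x_ne_y _ _)
  · have : 2 * q * w ∣ i - (c + q * k) := (h.x_eq_x _ _).1 hk.symm
    have h2 : q ∣ i - (c + q * k) := (Dvd.intro_left 2 rfl |>.mul_right w).trans this
    have := dvd_add h2 (dvd_mul_right q k)
    rwa [show i - (c + q * k) + q * k = i - c by ring] at this

/-- `x (w * n)` exchanges `y 0` and `y 1`, so all `y j` are generated. These act on the class of `w
* n` by `m ↦ 2 * j - 1 - m`, which reaches odd `m` from `0` in one step and even `m` in two. -/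
theorem geodesic_y_x (h : IsParametrization q w x y) (hqw : IsCoprime q w) (n : ℤ) :
    geodesic (y 0) (x (w * n)) = shortSet q x y (w * n) := by
  refine (geodesic_subset (h.isSubquandle_shortSet hqw _) (y_mem_shortSet _ _)
    (x_mem_shortSet_of_dvd (by simp))).antisymm ?_
  set G := geodesic (y 0) (x (w * n)) with hG
  have hx0 : x (w * n + q * 0) ∈ G := by
    rw [mul_zero, add_zero]; exact right_mem_geodesic _ _
  have hy0 : y 0 ∈ G := left_mem_geodesic _ _
  have hy1 : y (0 + 1) ∈ G := by
    have := act_mem_geodesic hy0 hx0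
    rw [show x (w * n + q * 0) ◃ y 0 = y _ from h.xy 0 n 0] at this
    exact this
  have hy : ∀ j, y j ∈ G := by
    refine Int.two_step_induction (P := fun j => y j ∈ G) 0 hy0 hy1 ?_ ?_
    · intro j h0 h1
      have := act_mem_geodesic h0 h1
      rw [h.act_y_y] at this
      convert this using 2; ring
    · intro j h0 h1
      have := act_mem_geodesic h1 h0
      rw [h.act_y_y] at this
      convert this using 2; ring
  have step : ∀ j m, x (w * n + q * m) ∈ G → x (w * n + q * (2 * j - 1 - m)) ∈ G := by
    intro j m hm
    have := act_mem_geodesic hm (hy j)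
    rw [show y j ◃ x (w * n + q * m) = x _ from h.yx j n m] at this
    convert this using 2; ring
  rintro _ (⟨j, rfl⟩ | ⟨m, rfl⟩)
  · exact hy j
  · rcases Int.even_or_odd' m with ⟨k, rfl | rfl⟩
    · have := step (k + 1) _ (step 1 0 hx0)
      convert this using 4; ring
    · have := step (k + 1) 0 hx0
      convert this using 4; ring

/-- The generated indices form a progression of difference `d`, which meets every residue when `d`
is prime to the period. -/
theorem geodesic_x_x (h : IsParametrization q w x y) {d : ℤ} (hd : IsCoprime d (2 * q * w)) (a : ℤ) :
    geodesic (x a) (x (a + d)) = Set.range x := by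
  refine (geodesic_subset h.isSubquandle_range_x ⟨_, rfl⟩ ⟨_, rfl⟩).antisymm ?_
  have key : ∀ k, x (a + d * k) ∈ geodesic (x a) (x (a + d)) := by
    refine Int.two_step_induction (P := fun k => x (a + d * k) ∈ geodesic (x a) (x (a + d))) 0
      ?_ ?_ ?_ ?_
    · rw [mul_zero, add_zero]; exact left_mem_geodesic _ _
    · rw [zero_add, mul_one]; exact right_mem_geodesic _ _
    · intro k h0 h1
      have := act_mem_geodesic h0 h1
      rw [h.act_x_x] at this
      convert this using 2; ring
    · intro k h0 h1
      have := act_mem_geodesic h1 h0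
      rw [h.act_x_x] at this
      convert this using 2; ring
  rintro _ ⟨i, rfl⟩
  obtain ⟨u, v, e⟩ := hd
  have : x i = x (a + d * (u * (i - a))) := by
    rw [h.x_eq_x]
    exact ⟨v * (i - a), by linear_combination -(i - a) * e⟩
  rw [this]
  exact key _

theorem exists_geodesic_subset (h : IsParametrization q w x y) (hqw : IsCoprime q w) (a b : Q) :
    geodesic a b ⊆ Set.range x ∨ ∃ c, geodesic a b ⊆ shortSet q x y c := by
  obtain ⟨i, rfl⟩ | ⟨i, rfl⟩ := h.surj a <;> obtain ⟨j, rfl⟩ | ⟨j, rfl⟩ := h.surj b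
  · exact Or.inl (geodesic_subset h.isSubquandle_range_x ⟨i, rfl⟩ ⟨j, rfl⟩)
  · exact Or.inr ⟨i, geodesic_subset (h.isSubquandle_shortSet hqw i)
      (x_mem_shortSet_of_dvd (by simp)) (y_mem_shortSet _ _)⟩
  · exact Or.inr ⟨j, geodesic_subset (h.isSubquandle_shortSet hqw j) (y_mem_shortSet _ _)
      (x_mem_shortSet_of_dvd (by simp))⟩
  · exact Or.inr ⟨0, geodesic_subset (h.isSubquandle_shortSet hqw 0) (y_mem_shortSet _ _)
      (y_mem_shortSet _ _)⟩

theorem dvd_of_shortSet_subset (h : IsParametrization q w x y) {c c' : ℤ}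
    (hc : shortSet q x y c ⊆ shortSet q x y c') : q ∣ c - c' :=
  h.x_mem_shortSet.1 (hc (x_mem_shortSet_of_dvd (by simp)))

theorem shortSet_inter (h : IsParametrization q w x y) {c c' : ℤ} (hc : ¬ q ∣ c - c') :
    shortSet q x y c ∩ shortSet q x y c' = Set.range y := by
  refine Set.Subset.antisymm ?_ fun a ha => ⟨Or.inl ha, Or.inl ha⟩
  rintro _ ⟨h1 | ⟨k, rfl⟩, h2⟩
  · exact h1
  · refine absurd ?_ hc
    have := dvd_sub (h.x_mem_shortSet.1 h2) (dvd_mul_right q k)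
    rwa [show c + q * k - c' - q * k = c - c' by ring] at this

theorem ncard_range_x (h : IsParametrization q w x y) (hq : q ≠ 0) (hw : w ≠ 0) :
    (Set.range x).ncard = 2 * q.natAbs * w.natAbs := by
  rw [(Set.ncard_range_of_eq_iff_dvd (by positivity) h.x_eq_x).2, Int.natAbs_mul, Int.natAbs_mul]
  rfl

theorem ncard_shortSet (h : IsParametrization q w x y) (hq : q ≠ 0) (hw : w ≠ 0) (c : ℤ) :
    (shortSet q x y c).ncard = 4 * w.natAbs := by
  have hy := Set.ncard_range_of_eq_iff_dvd (by positivity) h.y_eq_y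
  have hx := Set.ncard_range_of_eq_iff_dvd (f := fun k => x (c + q * k)) (N := 2 * w)
    (by positivity) (by
      intro i j
      simp only [h.x_eq_x]
      rw [show c + q * i - (c + q * j) = q * (i - j) by ring,
        show 2 * q * w = q * (2 * w) by ring, mul_dvd_mul_iff_left hq])
  have hdisj : Disjoint (Set.range y) (Set.range fun k => x (c + q * k)) := by
    rw [Set.disjoint_left]
    rintro _ ⟨j, rfl⟩ ⟨k, hk⟩
    exact h.x_ne_y _ _ hk
  rw [shortSet, Set.ncard_union_eq hdisj hy.1 hx.1, hy.2, hx.2, Int.natAbs_mul]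
  change 2 * w.natAbs + 2 * w.natAbs = _
  ring

/-! ### Components of the Cayley graph in coordinates. -/

theorem reachable_x (h : IsParametrization q w x y) (hqw : IsCoprime q w) (s a b : ℤ) :
    (cayleyGraph {x 0, y 0, x (-w)}).Reachable (x (s + q * a + 2 * w * b)) (x s) := by
  set R := (cayleyGraph {x 0, y 0, x (-w)}).Reachable with hR
  have r1 : ∀ i, R (x i) (x (-i)) := by
    intro i
    have := reachable_act (gens := {x 0, y 0, x (-w)}) (g := x 0) (by simp) (x i)
    rw [h.act_x_x] at this
    simpa using this
  have r2 : ∀ i, R (x i) (x (2 * (-w) - i)) := by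
    intro i
    have := reachable_act (gens := {x 0, y 0, x (-w)}) (g := x (-w)) (by simp) (x i)
    rwa [h.act_x_x] at this
  have r3 : ∀ n m, R (x (w * n + q * m)) (x (w * n - q * m + (2 * 0 - 1) * q)) := by
    intro n m
    have := reachable_act (gens := {x 0, y 0, x (-w)}) (g := y 0) (by simp) (x (w * n + q * m))
    rwa [show y 0 ◃ x (w * n + q * m) = x _ from h.yx 0 n m] at this
  have iter : ∀ d : ℤ, (∀ i, R (x i) (x (i + d))) → ∀ k i : ℤ, R (x i) (x (i + d * k)) := by
    intro d hd k
    induction k using Int.induction_on with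
    | zero => intro i; rw [mul_zero, add_zero]
    | succ k ih =>
      intro i
      have := (ih i).trans (hd _)
      rwa [add_assoc, ← mul_add_one] at this
    | pred k ih =>
      intro i
      refine (ih i).trans ?_
      have := (hd (i + d * (-k - 1))).symm
      rwa [show i + d * (-(k : ℤ) - 1) + d = i + d * -k by ring] at this
  have t1 : ∀ i, R (x i) (x (i + 2 * w)) := by
    intro i
    have := (r2 i).trans (r1 _)
    rwa [show -(2 * (-w) - i) = i + 2 * w by ring] at this
  -- Acting by `y 0` and then `x 0` sends `w * n + q * m` to `-w * n + q * m + q`; translations by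
  -- `2 * w` restore the first summand.
  have t2 : ∀ i, R (x i) (x (i + q)) := by
    intro i
    obtain ⟨n, m, rfl⟩ := exists_rep hqw i
    have := ((r3 n m).trans (r1 _)).trans (iter _ t1 n _)
    rwa [show -(w * n - q * m + (2 * 0 - 1) * q) + 2 * w * n = w * n + q * m + q by ring] at this
  exact ((iter _ t2 a s).trans (iter _ t1 b _)).symm

theorem cayleyComponent_x_subset (h : IsParametrization q w x y) (hqw : IsCoprime q w) (i : ℤ) :
    cayleyComponent {x 0, y 0, x (-w)} (x i) ⊆ Set.range x := by
  refine cayleyComponent_subset h.act_act ?_ ⟨i, rfl⟩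
  rintro _ ⟨i, rfl⟩ g (rfl | rfl | rfl)
  · exact ⟨_, (h.act_x_x _ _).symm⟩
  · obtain ⟨k, hk⟩ := h.exists_act_y_x hqw 0 i
    exact ⟨_, hk.symm⟩
  · exact ⟨_, (h.act_x_x _ _).symm⟩

/-- For `q = 2 * k + 1` the translations by `q` and `2 * w` generate all translations: `1 = q - 2 *
k * (τ * q + σ * w)`. -/
theorem cayleyComponent_x_of_odd (h : IsParametrization q w x y) (hqw : IsCoprime q w)
    (hq : Odd q) : cayleyComponent {x 0, y 0, x (-w)} (x 0) = Set.range x := by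
  refine (h.cayleyComponent_x_subset hqw 0).antisymm ?_
  rintro _ ⟨i, rfl⟩
  rw [mem_cayleyComponent]
  obtain ⟨τ, σ, e⟩ := id hqw
  obtain ⟨k, hk⟩ := hq
  convert h.reachable_x hqw 0 (i - 2 * k * τ * i) (-k * σ * i) using 2
  linear_combination i * (2 * k) * e - i * hk

/-- Translations by `2 = 2 * τ * q + 2 * σ * w` are available, so `x 0` reaches all even indices
and, `w` being odd, `x (-w)` all odd ones. -/
theorem cayleyComponent_x_of_even (h : IsParametrization q w x y) (hqw : IsCoprime q w)
    (hw : Odd w) : cayleyComponent {x 0, y 0, x (-w)} (x 0) ∪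
      cayleyComponent {x 0, y 0, x (-w)} (x (-w)) = Set.range x := by
  refine (Set.union_subset (h.cayleyComponent_x_subset hqw 0)
    (h.cayleyComponent_x_subset hqw (-w))).antisymm ?_
  rintro _ ⟨i, rfl⟩
  obtain ⟨τ, σ, e⟩ := id hqw
  obtain ⟨k, hk⟩ := hw
  rcases Int.even_or_odd' i with ⟨l, rfl | rfl⟩
  · refine Or.inl (mem_cayleyComponent.2 ?_)
    convert h.reachable_x hqw 0 (2 * τ * l) (σ * l) using 2
    linear_combination -2 * l * e
  · refine Or.inr (mem_cayleyComponent.2 ?_)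
    convert h.reachable_x hqw (-w) (2 * τ * (l + k + 1)) (σ * (l + k + 1)) using 2
    linear_combination -2 * (l + k + 1) * e + hk

/-- On `y`, the generators `x 0` and `y 0` act by `j ↦ 1 - j` and `j ↦ -j`, whose composite is a
unit translation. -/
theorem cayleyComponent_y (h : IsParametrization q w x y) (hqw : IsCoprime q w) :
    cayleyComponent {x 0, y 0, x (-w)} (y 0) = Set.range y := by
  apply Set.Subset.antisymm
  · refine cayleyComponent_subset h.act_act ?_ ⟨0, rfl⟩
    rintro _ ⟨i, rfl⟩ g (rfl | rfl | rfl)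
    · obtain ⟨k, hk⟩ := h.exists_act_x_y hqw i 0
      exact ⟨_, hk.symm⟩
    · exact ⟨_, (h.act_y_y _ _).symm⟩
    · obtain ⟨k, hk⟩ := h.exists_act_x_y hqw i (-w)
      exact ⟨_, hk.symm⟩
  · rintro _ ⟨j, rfl⟩
    rw [mem_cayleyComponent]
    have r1 : ∀ j, (cayleyGraph {x 0, y 0, x (-w)}).Reachable (y (j + 1)) (y j) := by
      intro j
      have h1 := reachable_act (gens := {x 0, y 0, x (-w)}) (g := x 0) (by simp) (y (j + 1))
      have h2 := reachable_act (gens := {x 0, y 0, x (-w)}) (g := y 0) (by simp) (y (-j))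
      have h3 := h.xy (j + 1) 0 0
      simp only [mul_zero, add_zero] at h3
      rw [h3, show 0 + 1 - (j + 1) = -j by ring] at h1
      rw [h.act_y_y, show 2 * 0 - -j = j by ring] at h2
      exact h1.trans h2
    induction j using Int.induction_on with
    | zero => rfl
    | succ k ih => exact (r1 _).trans ih
    | pred k ih =>
      have := r1 (-k - 1)
      rw [sub_add_cancel] at this
      exact this.symm.trans ih

end IsParametrization

/-! ### Locating the listed geodesics and proving maximality. -/

theorem Int.isCoprime_two_right_of_odd {d : ℤ} (hd : Odd d) : IsCoprime d 2 := by
  obtain ⟨k, rfl⟩ := hd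
  exact ⟨1, -k, by ring⟩

namespace Link22

/-- The short geodesic with index `k` is `g(2, x (w * m))` for this number `m`. -/
def shortIndex (q k : ℕ) : ℤ :=
  if Odd q then if Even k then -(k + 1) else k
  else if Even k then if Even (k / 2) then ((k / 2 : ℕ) : ℤ) else -((k / 2 : ℕ) + 1)
  else if Even (k / 2) then -((k / 2 : ℕ) + 1) else ((k / 2 : ℕ) : ℤ)

/-- For odd `q` the values are the `q` odd numbers from `-q` to `q - 2`; for even `q` they are `q /
2` consecutive even and `q / 2` consecutive odd numbers. -/
theorem shortIndex_injOn {q j k : ℕ} (hj : j < q) (hk : k < q)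
    (h : (q : ℤ) ∣ shortIndex q j - shortIndex q k) : j = k := by
  have bound : ∀ {k : ℕ}, k < q → -q ≤ shortIndex q k ∧ shortIndex q k < q := by
    intro k hk
    unfold shortIndex
    split_ifs <;> constructor <;> omega
  obtain ⟨c, hc⟩ := h
  have hj' := bound hj
  have hk' := bound hk
  have hq : (0 : ℤ) < q := by omega
  -- All values lie in an interval of length `2 * q`, so only the multiples `-q`, `0`, `q` remain,
  -- and parity decides.
  have hc1 : c < 2 := by nlinarith
  have hc2 : -2 < c := by nlinarith
  clear bound hj' hk'
  simp only [shortIndex, Nat.odd_iff, Nat.even_iff] at hc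
  interval_cases c <;> split_ifs at hc <;> omega

variable {Q : Type} [Quandle Q] {q : ℕ} {w : ℤ} {x y : ℤ → Q}

open IsParametrization

/-- The second generator is `x (-(q + 2 * w))`, and `q + 2 * w` is prime to `2`, `q` and `w`. -/
theorem longGeodesic_of_odd (h : IsParametrization (q : ℤ) w x y) (hqw : IsCoprime (q : ℤ) w)
    (hq : Odd q) : geodesic (x 0) (wordAct (x 0) [x (-w), y 0]) = Set.range x := by
  have e : wordAct (x 0) [x (-w), y 0] = x (0 + (-(q + 2 * w))) := by
    have h1 := h.yx 0 (-2) 0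
    simp only [wordAct, List.foldl, h.act_x_x]
    rw [show 2 * -w - 0 = w * -2 + q * 0 by ring]
    refine h1.trans (congrArg x ?_)
    ring
  rw [e]
  refine h.geodesic_x_x (IsCoprime.neg_left ?_) 0
  have hq' : Odd (q : ℤ) := by exact_mod_cast hq
  refine IsCoprime.mul_right (IsCoprime.mul_right ?_ ?_) ?_
  · exact Int.isCoprime_two_right_of_odd (hq'.add_even (even_two_mul w))
  · have := ((Int.isCoprime_two_right_of_odd hq').symm.mul_left hqw.symm).add_mul_left_left 1
    rwa [mul_one, add_comm] at this
  · rw [mul_comm]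
    exact hqw.add_mul_left_left 2

theorem odd_of_isCoprime_of_even (hqw : IsCoprime (q : ℤ) w) (hq : Even q) : Odd w := by
  rw [← Int.not_even_iff_odd]
  intro hw
  have hq' : Even (q : ℤ) := by exact_mod_cast hq
  have := Int.isUnit_iff.1 (hqw.isUnit_of_dvd' hq'.two_dvd hw.two_dvd)
  omega

/-- The second generator is `x (-(q + w))`, and `q + w` is odd because `w` is. -/
theorem longGeodesic_of_even (h : IsParametrization (q : ℤ) w x y) (hqw : IsCoprime (q : ℤ) w)
    (hq : Even q) : geodesic (x 0) (wordAct (x (-w)) [y 0]) = Set.range x := by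
  have e : wordAct (x (-w)) [y 0] = x (0 + (-(q + w))) := by
    have h1 := h.yx 0 (-1) 0
    simp only [wordAct, List.foldl]
    rw [show -w = w * -1 + q * 0 by ring]
    refine h1.trans (congrArg x ?_)
    ring
  rw [e]
  refine h.geodesic_x_x (IsCoprime.neg_left ?_) 0
  have hq' : Even (q : ℤ) := by exact_mod_cast hq
  refine IsCoprime.mul_right (IsCoprime.mul_right ?_ ?_) ?_
  · exact Int.isCoprime_two_right_of_odd (hq'.add_odd (odd_of_isCoprime_of_even hqw hq))
  · have := hqw.symm.add_mul_left_left 1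
    rwa [mul_one, add_comm] at this
  · have := hqw.add_mul_left_left 1
    rwa [mul_one] at this

theorem shortGeodesic_eq (h : IsParametrization (q : ℤ) w x y) (hqw : IsCoprime (q : ℤ) w)
    (k : ℕ) :
    (if Odd q then geodesic (y 0) (wordAct (x (-w)) (altWord (x 0) (x (-w)) k))
      else if Even k then geodesic (y 0) (wordAct (x 0) (altWord (x (-w)) (x 0) (k / 2)))
      else geodesic (y 0) (wordAct (x (-w)) (altWord (x 0) (x (-w)) (k / 2)))) =
    shortSet q x y (w * shortIndex q k) := by
  rw [← h.geodesic_y_x hqw]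
  unfold shortIndex
  simp only [wordAct_altWord h.xx]
  split_ifs <;> congr 2 <;> ring

theorem injOn_shortSet (h : IsParametrization (q : ℤ) w x y) (hqw : IsCoprime (q : ℤ) w) {j k : ℕ}
    (hj : j < q) (hk : k < q)
    (hjk : shortSet q x y (w * shortIndex q j) ⊆ shortSet q x y (w * shortIndex q k)) : j = k := by
  have := h.dvd_of_shortSet_subset hjk
  rw [← mul_sub] at this
  exact shortIndex_injOn hj hk (hqw.dvd_of_dvd_mul_left this)

/-- Since `w` is invertible modulo `q`, the `q` numbers `w * shortIndex q k` are distinct residues,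
hence all of them. -/
theorem exists_shortIndex (hq : 0 < q) (hqw : IsCoprime (q : ℤ) w) (c : ℤ) :
    ∃ k < q, (q : ℤ) ∣ c - w * shortIndex q k := by
  have : NeZero q := ⟨hq.ne'⟩
  let f : Fin q → ZMod q := fun k => ((w * shortIndex q k : ℤ) : ZMod q)
  have hf : Function.Injective f := by
    intro j k hjk
    have := (ZMod.intCast_eq_intCast_iff_dvd_sub _ _ _).1 hjk
    rw [← mul_sub] at this
    exact Fin.ext (shortIndex_injOn k.2 j.2 (hqw.dvd_of_dvd_mul_left this)).symm
  have hb : Function.Bijective f :=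
    (Fintype.bijective_iff_injective_and_card f).2 ⟨hf, by simp⟩
  obtain ⟨k, hk⟩ := hb.2 (c : ZMod q)
  exact ⟨k, k.2, (ZMod.intCast_eq_intCast_iff_dvd_sub _ _ _).1 hk⟩

theorem maximalGeodesics_of_parametrization (h : IsParametrization (q : ℤ) w x y)
    (hqw : IsCoprime (q : ℤ) w) (hq : 2 ≤ q) (hw : w ≠ 0) {long : Set Q} {short : ℕ → Set Q}
    (hlong : long = Set.range x) (hlong' : ∃ a b, long = geodesic a b)
    (hshort : ∀ k, short k = shortSet q x y (w * shortIndex q k)) :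
    {G : Set Q | IsMaximalGeodesic G}.ncard = q + 1 ∧
    {G : Set Q | IsMaximalGeodesic G} = insert long (short '' Set.Iio q) ∧
    Set.InjOn short (Set.Iio q) ∧
    (∀ k < q, short k ≠ long) ∧
    long.ncard = 2 * q * w.natAbs ∧
    (∀ k < q, (short k).ncard = 4 * w.natAbs) ∧
    ∀ j < q, ∀ k < q, j ≠ k → short j ∩ short k = Set.range y := by
  have hq0 : (q : ℤ) ≠ 0 := by omega
  have hsl : ∀ k, ¬ short k ⊆ long := by
    intro k hk
    rw [hshort, hlong] at hk
    obtain ⟨i, hi⟩ := hk (y_mem_shortSet _ 0)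
    exact h.x_ne_y _ _ hi
  have hls : ∀ k, ¬ long ⊆ short k := by
    intro k hk
    rw [hshort, hlong] at hk
    -- As `q ≥ 2`, the next index is in another class modulo `q`, so the long geodesic leaves every
    -- short one.
    have := h.x_mem_shortSet.1 (hk ⟨w * shortIndex q k + 1, rfl⟩)
    rw [add_sub_cancel_left] at this
    have := Int.le_of_dvd one_pos this
    omega
  have hinj : ∀ j < q, ∀ k < q, short j ⊆ short k → j = k := by
    intro j hj k hk hjk
    rw [hshort, hshort] at hjk
    exact injOn_shortSet h hqw hj hk hjk
  have hinjOn : Set.InjOn short (Set.Iio q) := fun j hj k hk hjk => hinj j hj k hk hjk.subset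
  have hne : ∀ k < q, short k ≠ long := fun k _ hk => hsl k hk.subset
  have hset : {G : Set Q | IsMaximalGeodesic G} = insert long (short '' Set.Iio q) := by
    ext G
    rw [Set.mem_ofPred_eq, isMaximalGeodesic_iff_of_cover
      (F := fun i : Option (Fin q) => i.elim long fun k => short k)]
    · constructor
      · rintro ⟨_ | k, rfl⟩
        · exact Or.inl rfl
        · exact Or.inr ⟨k, k.2, rfl⟩
      · rintro (rfl | ⟨k, hk, rfl⟩)
        · exact ⟨none, rfl⟩
        · exact ⟨some ⟨k, hk⟩, rfl⟩
    · rintro (_ | k)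
      · exact hlong'
      · exact ⟨_, _, (hshort k).trans (h.geodesic_y_x hqw _).symm⟩
    · intro a b
      obtain hab | ⟨c, hc⟩ := h.exists_geodesic_subset hqw a b
      · exact ⟨none, hlong ▸ hab⟩
      · obtain ⟨k, hk, hck⟩ := exists_shortIndex (by omega) hqw c
        refine ⟨some ⟨k, hk⟩, ?_⟩
        rw [shortSet_congr hck, ← hshort] at hc
        exact hc
    · rintro (_ | j) (_ | k) hjk
      · rfl
      · exact absurd hjk (hls _)
      · exact absurd hjk (hsl _)
      · rw [Fin.ext (hinj j j.2 k k.2 hjk)]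
  refine ⟨?_, hset, hinjOn, hne, ?_, ?_, ?_⟩
  · rw [hset, Set.ncard_insert_of_notMem _ ((Set.finite_Iio q).image short), hinjOn.ncard_image,
      Set.ncard_eq_toFinset_card', Set.toFinset_Iio, Nat.card_Iio]
    rintro ⟨k, hk, hkl⟩
    exact hne k hk hkl
  · rw [hlong, h.ncard_range_x hq0 hw, Int.natAbs_natCast]
  · intro k _
    rw [hshort, h.ncard_shortSet hq0 hw]
  · intro j hj k hk hjk
    rw [hshort, hshort]
    refine h.shortSet_inter fun hdvd => hjk ?_
    rw [← mul_sub] at hdvd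
    exact shortIndex_injOn hj hk (hqw.dvd_of_dvd_mul_left hdvd)

theorem isCoprime_of_eq {p q : ℕ} {e w : ℤ} (hcop : Nat.Coprime p q)
    (hw : w = (e - 1) * (q : ℤ) - (p : ℤ)) : IsCoprime (q : ℤ) w := by
  have : IsCoprime (q : ℤ) (-(p : ℤ)) := (Nat.isCoprime_iff_coprime.2 hcop).symm.neg_right
  have := this.add_mul_left_right (e - 1)
  rwa [hw, sub_eq_add_neg, add_comm, mul_comm (e - 1)]

theorem exists_parametrization {p q : ℕ} {e w : ℤ} (hq : 0 < q) (hcop : Nat.Coprime p q)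
    (hw : w = (e - 1) * (q : ℤ) - (p : ℤ)) :
    ∃ x y : ℤ → Q₂ p q e, IsParametrization (q : ℤ) w x y ∧ gen₁ p q e = x 0 ∧
      gen₂ p q e = y 0 ∧ gen₃ p q e = x (-w) := by
  obtain ⟨_, htw⟩ := TangleDiagram.exists_isUniversalColoring_twists e
  obtain ⟨_, hA⟩ := TangleDiagram.exists_isUniversalColoring_rational 1 2 two_pos (by norm_num)
  obtain ⟨_, hC⟩ := TangleDiagram.exists_isUniversalColoring_rational p q hq hcop
  push_cast at hA
  exact TangleDiagram.exists_parametrization htw hA hA hC hw (isCoprime_of_eq hcop hw)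

end Link22

open Link22 in
theorem mainTheorem5 (p q : ℕ) (e : ℤ) (hp : 0 < p) (hpq : p < q) (hcop : Nat.Coprime p q)
    (w : ℤ) (hw : w = (e - 1) * (q : ℤ) - (p : ℤ)) :
    -- there are exactly `q + 1` maximal geodesics
    {G : Set (Q₂ p q e) | IsMaximalGeodesic G}.ncard = q + 1 ∧
    -- they are the long geodesic and the `q` distinct short ones
    {G : Set (Q₂ p q e) | IsMaximalGeodesic G} =
      insert (longGeodesic p q e) (shortGeodesic p q e '' Set.Iio q) ∧
    Set.InjOn (shortGeodesic p q e) (Set.Iio q) ∧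
    (∀ k < q, shortGeodesic p q e k ≠ longGeodesic p q e) ∧
    -- lengths
    (longGeodesic p q e).ncard = 2 * q * w.natAbs ∧
    (∀ k < q, (shortGeodesic p q e k).ncard = 4 * w.natAbs) ∧
    -- the long geodesic in terms of the components of the Cayley graph
    (Odd q → longGeodesic p q e = component p q e (gen₁ p q e)) ∧
    (Even q → longGeodesic p q e =
      component p q e (gen₁ p q e) ∪ component p q e (gen₃ p q e)) ∧
    -- any two of the short geodesics meet exactly in `C₂`
    (∀ j < q, ∀ k < q, j ≠ k →
      shortGeodesic p q e j ∩ shortGeodesic p q e k = component p q e (gen₂ p q e)) := by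
  have hqw := isCoprime_of_eq hcop hw
  -- `w = 0` would make `q` divide `p`, contrary to `0 < p < q`; nonzero periods make the geodesics
  -- finite.
  have hw0 : w ≠ 0 := by
    rintro rfl
    have hdvd : (q : ℤ) ∣ p := ⟨e - 1, by linarith⟩
    have := Nat.le_of_dvd hp (Int.natCast_dvd_natCast.1 hdvd)
    omega
  obtain ⟨x, y, h, h1, h2, h3⟩ := exists_parametrization (hp.trans hpq) hcop hw
  have hlong : longGeodesic p q e = Set.range x := by
    unfold longGeodesic
    rw [h1, h2, h3]
    split_ifs with hodd
    · exact longGeodesic_of_odd h hqw hodd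
    · exact longGeodesic_of_even h hqw (Nat.not_odd_iff_even.1 hodd)
  have hlong' : ∃ a b, longGeodesic p q e = geodesic a b := by
    unfold longGeodesic
    split_ifs
    · exact ⟨_, _, rfl⟩
    · exact ⟨_, _, rfl⟩
  have hshort : ∀ k, shortGeodesic p q e k =
      IsParametrization.shortSet q x y (w * shortIndex q k) := by
    intro k
    rw [← shortGeodesic_eq h hqw, shortGeodesic, h1, h2, h3]
  have hcomp : ∀ a, component p q e a = cayleyComponent {x 0, y 0, x (-w)} a := by
    intro a
    rw [component, h1, h2, h3]
  obtain ⟨m1, m2, m3, m4, m5, m6, m7⟩ :=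
    maximalGeodesics_of_parametrization h hqw (by omega) hw0 hlong hlong' hshort
  refine ⟨m1, m2, m3, m4, m5, m6, fun hq => ?_, fun hq => ?_, ?_⟩
  · rw [hlong, hcomp, h1, h.cayleyComponent_x_of_odd hqw (by exact_mod_cast hq)]
  · rw [hlong, hcomp, hcomp, h1, h3,
      h.cayleyComponent_x_of_even hqw (odd_of_isCoprime_of_even hqw hq)]
  · rw [hcomp, h2, h.cayleyComponent_y hqw]
    exact m7
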